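/- Setting. Let $F$ be a perfect field of characteristic $2$ with more than $4$ elements, $V$ a vector space over $F$ with $4\le\dim V<\infty$, and $\xi$ a nondegenerate symmetric bilinear form on $V$ that is not alternating (so $\xi$ determines a pseudo-polarity $\perp$ of the projective space $\mathfrak P$ over $V$). Subspaces of $\mathfrak P$ are identified with linear subspaces of $V$; points, lines and planes have linear dimension $1,2,3$. Let $\mathbf H=\{x\in V:\xi(x,x)=0\}$ (a hyperplane) and $\mathbf b=\mathbf H^\perp$ (a point). A subspace $A$ is *regular* if $A\cap A^\perp=0$, and *affine* if $A\not\subseteq\mathbf H$. Consider the following point-line geometries, with inclusion as incidence: * $\mathfrak B_1$: its points are the regular points different from $\mathbf b$, its lines are the regular affine lines; * $\mathfrak B_2$: its points are the regular lines not through $\mathbf b$, its lines are the regular planes; * $\mathfrak C_2$: its points are the regular affine lines not through $\mathbf b$, its lines are the regular planes. The language of point-line geometry is the first-order language whose only primitive notions are "point", "line" and "incident". Let $\mathfrak M$ be $\mathfrak B_2$ or $\mathfrak C_2$. That $\mathfrak B_1$ *is definable in terms of* $\mathfrak M$ means that there are a number $k$ and parameter-free first-order formulas in this language by which: the objects (points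 and lines) of $\mathfrak B_1$ are represented by the $k$-tuples of objects of $\mathfrak M$ that satisfy the first formula, every object being represented; and the relations "two tuples represent the same object", "a tuple represents a point", and "two tuples represent an incident point and line" are each expressed in $\mathfrak M$ by one of the formulas. Moreover the points of $\mathfrak B_1$ are identified with stars of lines: a further formula expresses in $\mathfrak M$ that a point $L$ of $\mathfrak M$ is a line of $\mathfrak P$ passing through the point of $\mathfrak B_1$ represented by a given tuple. **Theorem 5.14.** The structure $\mathfrak B_1$ is definable in terms of $\mathfrak B_2$, and it is definable in terms of $\mathfrak C_2$. In each of the two cases one and the same system of formulas serves for all $F$, $V$ and $\xi$ as above. -/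

import Mathlib

universe u v

/-! ## Point-line geometries as first-order structures -/

/-- A point-line geometry: points, lines, and an incidence relation between them. -/
structure PointLineGeometry where
  Pt : Type u
  Ln : Type u
  Inc : Pt → Ln → Prop

/-- The relation symbols of the language of point-line geometry: "`x` is a point" (the objects
that are not points are the lines) and "`x` is a point, `y` is a line and `x` is incident
with `y`". -/
inductive IncidenceRel : ℕ → Type
  | point : IncidenceRel 1
  | inc : IncidenceRel 2

/-- The first-order language of point-line geometry. It has no functions and no constants. -/
def incidenceLanguage : FirstOrder.Language.{0, 0} where
  Functions := fun _ => Empty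
  Relations := IncidenceRel

namespace PointLineGeometry

/-- The objects (points and lines) of a point-line geometry. -/
def Obj (X : PointLineGeometry.{u}) : Type u := X.Pt ⊕ X.Ln

/-- A point, as an object of the geometry. -/
def ofPt (X : PointLineGeometry.{u}) (p : X.Pt) : X.Obj := Sum.inl p

/-- A line, as an object of the geometry. -/
def ofLn (X : PointLineGeometry.{u}) (l : X.Ln) : X.Obj := Sum.inr l

/-- The meaning of the relation symbols. -/
def interpRel (X : PointLineGeometry.{u}) : {n : ℕ} → IncidenceRel n → (Fin n → X.Obj) → Prop
  | _, IncidenceRel.point, x => ∃ p : X.Pt, x 0 = X.ofPt p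
  | _, IncidenceRel.inc, x => ∃ (p : X.Pt) (l : X.Ln), x 0 = X.ofPt p ∧ x 1 = X.ofLn l ∧ X.Inc p l

instance (X : PointLineGeometry.{u}) : incidenceLanguage.Structure X.Obj where
  funMap := fun f _ => Empty.elim f
  RelMap := fun r x => X.interpRel r x

end PointLineGeometry

/-- The formulas of a (many-dimensional, parameter-free) first-order definition of one point-line
geometry in terms of another one. Objects of the defined geometry are represented by `k`-tuples
of objects of the given geometry; the formulas say which tuples represent an object, when two
tuples represent the same object, when a tuple represents a point, when two tuples represent an
incident pair; finally `star` says when a point of the given geometry belongs to the star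
attached to a tuple. -/
structure GeometryDefinition where
  k : ℕ
  dom : incidenceLanguage.Formula (Fin k)
  eqv : incidenceLanguage.Formula (Fin k ⊕ Fin k)
  rel : ∀ {n : ℕ}, incidenceLanguage.Relations n → incidenceLanguage.Formula (Fin n × Fin k)
  star : incidenceLanguage.Formula (Fin k ⊕ Unit)

/-- `D.Defines M N S`: the formulas of `D`, evaluated in `M`, define `N` in terms of `M`. That is,
there is a map `c` from the set of all tuples satisfying the domain formula onto the set of objects
of `N` (a tuple is sent to the object it represents), such that equality of represented objects and
the primitive relations of `N` are expressed by the respective formulas. Moreover, the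
representation is the prescribed one: a point `p` of `N` is identified with the set of those points
`L` of `M` that satisfy `S p L`. -/
def GeometryDefinition.Defines (D : GeometryDefinition) (M N : PointLineGeometry.{u})
    (S : N.Pt → M.Pt → Prop) : Prop :=
  ∃ c : {x : Fin D.k → M.Obj // D.dom.Realize x} → N.Obj,
    Function.Surjective c ∧
    (∀ x y, c x = c y ↔ D.eqv.Realize (Sum.elim x.1 y.1)) ∧
    (∀ {n : ℕ} (r : incidenceLanguage.Relations n)
        (x : Fin n → {x : Fin D.k → M.Obj // D.dom.Realize x}),
      FirstOrder.Language.Structure.RelMap r (fun i => c (x i)) ↔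
        (D.rel r).Realize (fun ij : Fin n × Fin D.k => (x ij.1).1 ij.2)) ∧
    (∀ x (p : N.Pt), c x = N.ofPt p → ∀ L : M.Pt,
      S p L ↔ D.star.Realize (Sum.elim x.1 (fun _ => M.ofPt L)))

/-! ## Pseudo-polarities -/

/-- A pseudo-polarity of the projective space over `V` (in characteristic two), given by a
nondegenerate symmetric bilinear form that is not alternating. -/
structure PseudoPolarity (F : Type u) [Field F] [CharP F 2] (V : Type v) [AddCommGroup V]
    [Module F V] where
  form : LinearMap.BilinForm F V
  isSymm : form.IsSymm
  nondegenerate : form.Nondegenerate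
  not_isAlt : ¬ form.IsAlt

namespace PseudoPolarity

variable {F : Type u} [Field F] [CharP F 2] {V : Type v} [AddCommGroup V] [Module F V]

/-- The subspace `H` of the selfconjugate points (a hyperplane if `F` is perfect). -/
def H (ξ : PseudoPolarity F V) : Submodule F V where
  carrier := {x | ξ.form x x = 0}
  zero_mem' := by simp
  add_mem' := by
    intro x y hx hy
    have h := ξ.isSymm.eq x y
    simp only [Set.mem_ofPred_eq] at *
    rw [map_add, map_add, LinearMap.add_apply, LinearMap.add_apply, hx, hy, ← h]
    simp [CharTwo.add_self_eq_zero]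
  smul_mem' := by
    intro a x hx
    simp only [Set.mem_ofPred_eq] at *
    simp [hx]

/-- The pole `b` of `H`. -/
def b (ξ : PseudoPolarity F V) : Submodule F V := ξ.form.orthogonal ξ.H

/-- The set of regular subspaces of (linear) dimension `k`, i.e. those with trivial radical. -/
def R (ξ : PseudoPolarity F V) (k : ℕ) : Set (Submodule F V) :=
  {A | Module.finrank F A = k ∧ A ⊓ ξ.form.orthogonal A = ⊥}

/-- Regular subspaces of dimension `k` that are affine, i.e. not contained in `H`. -/
def affineR (ξ : PseudoPolarity F V) (k : ℕ) : Set (Submodule F V) := {A ∈ ξ.R k | ¬ A ≤ ξ.H}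

/-- Regular subspaces of dimension `k` that do not pass through `b`. -/
def offPoleR (ξ : PseudoPolarity F V) (k : ℕ) : Set (Submodule F V) := {A ∈ ξ.R k | ¬ ξ.b ≤ A}

/-- The geometry with given sets of subspaces as points and lines, and inclusion as incidence. -/
def geometryOf (P L : Set (Submodule F V)) : PointLineGeometry.{v} where
  Pt := P
  Ln := L
  Inc := fun p l => p.1 ≤ l.1

/-- The geometry of regular points different from `b` and regular affine lines. -/
def B₁ (ξ : PseudoPolarity F V) : PointLineGeometry.{v} := geometryOf (ξ.offPoleR 1) (ξ.affineR 2)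

/-- The geometry of regular lines not through `b` and regular planes. -/
def B₂ (ξ : PseudoPolarity F V) : PointLineGeometry.{v} := geometryOf (ξ.offPoleR 2) (ξ.R 3)

/-- The geometry of regular affine lines not through `b` and regular planes. -/
def C₂ (ξ : PseudoPolarity F V) : PointLineGeometry.{v} :=
  geometryOf (ξ.affineR 2 ∩ ξ.offPoleR 2) (ξ.R 3)

/-- A projective point lies on a projective line; here the points of the second geometry are
lines of the projective space. -/
def LiesOn {P L P' L' : Set (Submodule F V)} (p : (geometryOf P L).Pt)
    (K : (geometryOf P' L').Pt) : Prop :=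
  (Subtype.val p : Submodule F V) ≤ (Subtype.val K : Submodule F V)

end PseudoPolarity

-- Let `P` be the point set of `B₂` or of `C₂`; the same formulas serve both. Three lines that lie
-- pairwise in regular planes, but not all in one, are concurrent (`Tripod.inf_le`). A chain of
-- three such tripods therefore expresses that a line of `P` passes through the common point of two
-- others, and general position shows that it reaches every such line (`IsFrame.through_iff`). This
-- gives the stars.
--
-- General position rests on a vector `e` spanning the pole with ξ(x,x) = ξ(x,e)², which exists
-- since square roots are additive in characteristic 2. Gram determinants of pairs become squares of
-- expressions linear in each vector, so a good line through a given point only has to avoid a few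
-- proper subspaces. At most seven occur, and a field of characteristic 2 with more than 4 elements
-- has at least 7 nonzero elements, which suffices.
--
-- The affine points (those not selfconjugate) are singled out next. Such a point p has a regular
-- plane A through it and a line K of `P` through it, off A, that is coplanar with every line of `P`
-- in A through p (`IsFrame.exists_meetAffine`). At a selfconjugate point this fails, because a
-- regular plane contains no totally isotropic line (`IsFrame.meetAffine_imp`).
--
-- A regular affine line is coded by two of its affine points. If it misses the pole, it belongs to
-- `P`. If it passes through the pole, it is not an object of the given geometry, but it is
-- recognised negatively: no line of `P` through the first point is coplanar with one through the
-- second (`IsFrame.linked_iff`). Objects of `B₁` thus become quadruples of lines: two pairs, each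
-- determining an affine point, which coincide exactly when the object is a point.

universe w

namespace PseudoPolarity

open Submodule Module

/-! ### Avoiding finitely many proper subspaces. -/

section Covering

variable {F : Type*} [Field F] {V : Type*} [AddCommGroup V] [Module F V]

/-- A subspace is not covered by a few subspaces that do not contain it. -/
theorem exists_mem_forall_notMem (t : Finset F) (h0 : (0 : F) ∉ t) (W : Submodule F V) :
    ∀ l : List (Submodule F V), l.length ≤ t.card → (∀ S ∈ l, ¬ W ≤ S) →
      ∃ y ∈ W, ∀ S ∈ l, y ∉ S := by
  classical
  intro l
  induction l with
  | nil => intro _ _; exact ⟨0, W.zero_mem, by simp⟩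
  | cons S l ih =>
    intro hl hS
    simp only [List.length_cons] at hl
    obtain ⟨y, hyW, hy⟩ := ih (by omega) fun T hT => hS T (List.mem_cons_of_mem _ hT)
    by_cases hyS : y ∈ S
    · obtain ⟨z, hzW, hzS⟩ := SetLike.not_le_iff_exists.1 (hS S List.mem_cons_self)
      -- Move y in the direction z. Each y + a z with a in `t` misses `S`; if all were covered, two
      -- of them would share a subspace of `l`, which would then contain z and y.
      by_contra! hcon
      have key : ∀ a ∈ t, ∃ T ∈ l, y + a • z ∈ T := by
        intro a ha
        obtain ⟨T, hT, hmem⟩ := hcon (y + a • z) (W.add_mem hyW (W.smul_mem a hzW))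
        rcases List.mem_cons.1 hT with rfl | hT
        · exfalso
          have h1 : a • z ∈ T := by simpa using T.sub_mem hmem hyS
          have ha0 : a ≠ 0 := fun h => h0 (h ▸ ha)
          exact hzS ((T.smul_mem_iff ha0).1 h1)
        · exact ⟨T, hT, hmem⟩
      choose! f hf hf' using key
      obtain ⟨a, ha, c, hc, hac, hfac⟩ := Finset.exists_ne_map_eq_of_card_lt_of_maps_to
        (s := t) (t := l.toFinset) (f := f)
        (lt_of_le_of_lt (List.toFinset_card_le l) (by omega)) (fun a ha => by simpa using hf a ha)
      have h1 := hf' a ha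
      have h2 := hf' c hc
      rw [← hfac] at h2
      have h3 : (a - c) • z ∈ f a := by
        have := (f a).sub_mem h1 h2
        rwa [add_sub_add_left_eq_sub, ← sub_smul] at this
      have hz : z ∈ f a := ((f a).smul_mem_iff (sub_ne_zero.2 hac)).1 h3
      refine hy (f a) (hf a ha) ?_
      simpa using (f a).sub_mem h1 ((f a).smul_mem a hz)
    · refine ⟨y, hyW, fun T hT => ?_⟩
      rcases List.mem_cons.1 hT with rfl | hT
      exacts [hyS, hy T hT]

/-- A field of characteristic two with more than four elements has seven nonzero elements. -/
theorem exists_seven_le_card [CharP F 2] (hF : 5 ≤ ENat.card F) :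
    ∃ t : Finset F, (0 : F) ∉ t ∧ 7 ≤ t.card := by
  classical
  rcases finite_or_infinite F with hfin | hinf
  · have := Fintype.ofFinite F
    obtain ⟨n, -, hn⟩ := FiniteField.card F 2
    rw [ENat.card_eq_coe_fintype_card, hn] at hF
    have h5 : 5 ≤ 2 ^ (n : ℕ) := by exact_mod_cast hF
    have h3 : 3 ≤ (n : ℕ) := by
      by_contra! h
      interval_cases (n : ℕ) <;> omega
    have h8 : 2 ^ 3 ≤ 2 ^ (n : ℕ) := Nat.pow_le_pow_right (by norm_num) h3
    refine ⟨Finset.univ.erase 0, by simp, ?_⟩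
    rw [Finset.card_erase_of_mem (Finset.mem_univ _), Finset.card_univ, hn]
    omega
  · obtain ⟨s, hs⟩ := Infinite.exists_subset_card_eq F 8
    refine ⟨s.erase 0, by simp, ?_⟩
    have := Finset.pred_card_le_card_erase (s := s) (a := (0 : F))
    omega

end Covering

/-! ### The pole vector and regularity of points and lines. -/

variable {F : Type u} [Field F] [CharP F 2] {V : Type v} [AddCommGroup V] [Module F V]
  {ξ : PseudoPolarity F V}

/-- A vector that spans the pole of the hyperplane of selfconjugate points, scaled so that it
represents the square root of the quadratic form `x ↦ ξ(x, x)`. -/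
structure IsPole (ξ : PseudoPolarity F V) (e : V) : Prop where
  ne_zero : e ≠ 0
  self_eq : ∀ x, ξ.form x x = ξ.form x e ^ 2

/-- Over a perfect field of characteristic 2 the map x ↦ √ξ(x,x) is linear, so nondegeneracy
represents it by a vector e; e = 0 would make the form alternating. -/
theorem exists_isPole [PerfectField F] [FiniteDimensional F V] (ξ : PseudoPolarity F V) :
    ∃ e, IsPole ξ e := by
  have hfrob : ∀ x : F, (frobeniusEquiv F 2).symm x ^ 2 = x := fun x => by
    rw [← frobeniusEquiv_def]; simp
  let q : V →ₗ[F] F :=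
    { toFun := fun x => (frobeniusEquiv F 2).symm (ξ.form x x)
      map_add' := fun x y => by
        rw [← map_add]
        congr 1
        have h := ξ.isSymm.eq x y
        simp only [map_add, LinearMap.add_apply]
        rw [← h]
        linear_combination CharTwo.add_self_eq_zero (ξ.form x y)
      map_smul' := fun a x => by
        have : ξ.form (a • x) (a • x) = frobeniusEquiv F 2 a * ξ.form x x := by
          rw [frobeniusEquiv_def]; simp; ring
        rw [this, map_mul]; simp }
  have hq : ∀ x, q x ^ 2 = ξ.form x x := fun x => hfrob _
  let e := (LinearMap.BilinForm.toDual ξ.form ξ.nondegenerate).symm q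
  have he : ∀ x, ξ.form x e = q x := fun x => by
    rw [← ξ.isSymm.eq]
    exact LinearMap.BilinForm.apply_toDual_symm_apply (hB := ξ.nondegenerate) q x
  refine ⟨e, ?_, fun x => by rw [he, hq]⟩
  intro h0
  refine ξ.not_isAlt fun x => ?_
  rw [← hq, ← he, h0]
  simp

theorem range_pair {W : Type*} (x y : W) : Set.range ![x, y] = {x, y} := by
  ext; simp [eq_comm, or_comm]

theorem range_triple {W : Type*} (x y z : W) : Set.range ![x, y, z] = {x, y, z} := by
  ext; simp [eq_comm]; tauto

theorem form_comm (ξ : PseudoPolarity F V) (x y : V) : ξ.form x y = ξ.form y x :=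
  (ξ.isSymm.eq x y).symm ▸ rfl

theorem isRefl (ξ : PseudoPolarity F V) : ξ.form.IsRefl := ξ.isSymm.isRefl

theorem eq_zero_of_form (ξ : PseudoPolarity F V) {x : V} (h : ∀ y, ξ.form x y = 0) : x = 0 :=
  ξ.nondegenerate.1 x h

theorem mem_R {k : ℕ} {A : Submodule F V} :
    A ∈ ξ.R k ↔ finrank F A = k ∧ ∀ x ∈ A, (∀ y ∈ A, ξ.form x y = 0) → x = 0 := by
  refine and_congr_right fun _ => ?_
  rw [Submodule.eq_bot_iff]
  simp only [Submodule.mem_inf, LinearMap.BilinForm.mem_orthogonal_iff, and_imp]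
  refine forall₂_congr fun x _ => imp_congr_left (forall₂_congr fun y _ => ?_)
  rw [ξ.form_comm]

/-- The subspace `v^⊥`. -/
def perp (ξ : PseudoPolarity F V) (v : V) : Submodule F V := LinearMap.ker (ξ.form v)

@[simp] theorem mem_perp {v x : V} : x ∈ ξ.perp v ↔ ξ.form v x = 0 := LinearMap.mem_ker

theorem not_top_le_perp {v : V} (hv : v ≠ 0) : ¬ ⊤ ≤ ξ.perp v := fun h =>
  hv (ξ.eq_zero_of_form fun y => mem_perp.1 (h (Submodule.mem_top (x := y))))

theorem span_range_mem_R {k : ℕ} (w : Fin k → V)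
    (h : ∀ c : Fin k → F, (∀ j, ξ.form (∑ i, c i • w i) (w j) = 0) → c = 0) :
    span F (Set.range w) ∈ ξ.R k := by
  have hli : LinearIndependent F w := by
    rw [Fintype.linearIndependent_iff]
    intro c hc
    exact congrFun (h c fun j => by rw [hc]; simp)
  refine mem_R.2 ⟨by simpa using finrank_span_eq_card hli, fun x hx hxy => ?_⟩
  obtain ⟨c, rfl⟩ := (mem_span_range_iff_exists_fun F).1 hx
  rw [h c fun j => hxy _ (subset_span ⟨j, rfl⟩)]
  simp

theorem span_triple_mem_R {x y z : V}
    (h : ∀ a b c : F, ξ.form (a • x + b • y + c • z) x = 0 → ξ.form (a • x + b • y + c • z) y = 0 →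
      ξ.form (a • x + b • y + c • z) z = 0 → a = 0 ∧ b = 0 ∧ c = 0) :
    span F {x, y, z} ∈ ξ.R 3 := by
  rw [← range_triple]
  refine span_range_mem_R _ fun c hc => ?_
  simp only [Fin.sum_univ_three] at hc
  obtain ⟨h0, h1, h2⟩ := h (c 0) (c 1) (c 2) (hc 0) (hc 1) (hc 2)
  ext i
  fin_cases i <;> assumption

omit [CharP F 2] in
/-- Coordinates of the elements of a span of two vectors that has dimension two. -/
theorem eq_zero_of_finrank_pair {x y : V} (h : finrank F (span F {x, y}) = 2) {a c : F}
    (hac : a • x + c • y = 0) : a = 0 ∧ c = 0 := by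
  have hli : LinearIndependent F ![x, y] := by
    rw [linearIndependent_iff_card_eq_finrank_span, Set.finrank, range_pair, h]; simp
  exact LinearIndependent.pair_iff.1 hli a c hac

/-- A Gram matrix with square diagonal entries in characteristic two. -/
theorem eq_zero_of_gram {F : Type*} [Field F] [CharP F 2] {s r t a c : F} (h : s * r ≠ t)
    (h0 : a * s ^ 2 + c * t = 0) (h1 : a * t + c * r ^ 2 = 0) : a = 0 ∧ c = 0 := by
  -- In characteristic 2 the Gram determinant s²r² - t² equals (s r - t)²; the multiples of `h2`
  -- below absorb the cross terms.
  have hd : (s * r - t) ^ 2 ≠ 0 := pow_ne_zero _ (sub_ne_zero.2 h)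
  have h2 := CharTwo.two_eq_zero (R := F)
  constructor
  · refine (mul_eq_zero.1 (?_ : a * _ = 0)).resolve_right hd
    linear_combination r ^ 2 * h0 - t * h1 + a * (t ^ 2 - s * r * t) * h2
  · refine (mul_eq_zero.1 (?_ : c * _ = 0)).resolve_right hd
    linear_combination s ^ 2 * h1 - t * h0 + c * (t ^ 2 - s * r * t) * h2

namespace IsPole

variable {e : V} (he : IsPole ξ e)
include he

theorem mem_H {x : V} : x ∈ ξ.H ↔ ξ.form x e = 0 := by
  change ξ.form x x = 0 ↔ _
  rw [he.self_eq]; simp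

theorem b_eq [FiniteDimensional F V] : ξ.b = span F {e} := by
  have : ξ.H = ξ.form.orthogonal (span F {e}) := by
    ext x
    rw [he.mem_H, LinearMap.BilinForm.mem_orthogonal_iff]
    constructor
    · intro h y hy
      obtain ⟨a, rfl⟩ := mem_span_singleton.1 hy
      change ξ.form (a • e) x = 0
      rw [ξ.form_comm]
      simp [h]
    · intro h
      rw [ξ.form_comm]
      exact h e (mem_span_singleton_self e)
  rw [b, this, LinearMap.BilinForm.orthogonal_orthogonal ξ.nondegenerate ξ.isRefl]

theorem b_le_iff [FiniteDimensional F V] {A : Submodule F V} : ξ.b ≤ A ↔ e ∈ A := by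
  rw [he.b_eq, span_singleton_le_iff_mem]

/-- The Gram determinant of x, y is the square of ξ(x,e) ξ(y,e) - ξ(x,y). -/
theorem pair_mem_R_iff {x y : V} :
    span F {x, y} ∈ ξ.R 2 ↔ ξ.form x e * ξ.form y e ≠ ξ.form x y := by
  constructor
  · intro h hs
    obtain ⟨hd, hrad⟩ := mem_R.1 h
    have hx : x ∈ span F {x, y} := subset_span (by simp)
    have hy : y ∈ span F {x, y} := subset_span (by simp)
    have hmem : ∀ a c : F, (∀ z ∈ ({x, y} : Set V), ξ.form (a • x + c • y) z = 0) →
        a = 0 ∧ c = 0 := by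
      intro a c hac
      refine eq_zero_of_finrank_pair hd (hrad _ (add_mem (smul_mem _ _ hx) (smul_mem _ _ hy)) ?_)
      intro z hz
      have : span F {x, y} ≤ ξ.perp (a • x + c • y) := span_le.2 fun z hz => mem_perp.2 (hac z hz)
      exact mem_perp.1 (this hz)
    -- When the determinant vanishes, ξ(y,e) x - ξ(x,e) y lies in the radical. If its coefficients
    -- vanish too, the whole Gram matrix is zero and x itself is in the radical.
    obtain ⟨hy0, hx0⟩ := hmem (ξ.form y e) (-ξ.form x e) (by
      simp [he.self_eq, ξ.form_comm y x, ← hs]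
      constructor <;> ring)
    have := hmem 1 0 (by simp [he.self_eq, ← hs, hy0, neg_eq_zero.1 hx0])
    simp at this
  · intro h
    rw [← range_pair]
    refine span_range_mem_R _ fun c hc => ?_
    have h0 := hc 0
    have h1 := hc 1
    simp [he.self_eq, ξ.form_comm y x] at h0 h1
    obtain ⟨hc0, hc1⟩ := eq_zero_of_gram h h0 h1
    ext i
    fin_cases i <;> assumption

/-- For fixed x the exceptional y form the perp of a single vector, which is the shape needed for
the avoidance arguments. -/
theorem pair_mem_R_iff' {x y : V} :
    span F {x, y} ∈ ξ.R 2 ↔ y ∉ ξ.perp (ξ.form x e • e - x) := by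
  rw [he.pair_mem_R_iff, mem_perp, map_sub, LinearMap.sub_apply, sub_eq_zero.not, map_smul,
    LinearMap.smul_apply, smul_eq_mul, ξ.form_comm e y]

theorem singleton_mem_R_iff {x : V} : span F {x} ∈ ξ.R 1 ↔ ξ.form x e ≠ 0 := by
  constructor
  · intro h hx
    obtain ⟨hd, hrad⟩ := mem_R.1 h
    have h0 := hrad x (mem_span_singleton_self x) fun y hy => by
      obtain ⟨a, rfl⟩ := mem_span_singleton.1 hy
      simp [he.self_eq, hx]
    rw [h0, span_zero_singleton, finrank_bot] at hd
    omega
  · intro h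
    have hx0 : x ≠ 0 := by rintro rfl; simp at h
    refine mem_R.2 ⟨finrank_span_singleton hx0, fun z hz hzy => ?_⟩
    obtain ⟨a, rfl⟩ := mem_span_singleton.1 hz
    have := hzy x (mem_span_singleton_self x)
    simp [he.self_eq, h] at this
    simp [this]

end IsPole

/-! ### Regular planes, and generic lines through a point. -/

/-- A regular plane contains no two independent orthogonal selfconjugate vectors. -/
theorem exists_smul_eq_of_isotropic {A : Submodule F V} (hA : A ∈ ξ.R 3) {g h : V} (hg : g ∈ A)
    (hh : h ∈ A) (hgg : ξ.form g g = 0) (hhh : ξ.form h h = 0) (hgh : ξ.form g h = 0)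
    (hg0 : g ≠ 0) : ∃ a : F, h = a • g := by
  by_contra! hne
  obtain ⟨hd, hrad⟩ := mem_R.1 hA
  have hli : LinearIndependent F ![g, h] :=
    (LinearIndependent.pair_iff' hg0).2 fun a ha => hne a ha.symm
  have hT := finrank_span_eq_card hli
  rw [range_pair, Fintype.card_fin] at hT
  have hTA : span F {g, h} ≤ A := span_le.2 (by rintro x (rfl | rfl) <;> assumption)
  have hfin : FiniteDimensional F A := FiniteDimensional.of_finrank_pos (by omega)
  obtain ⟨x, hxA, hxT⟩ : ∃ x ∈ A, x ∉ span F {g, h} := by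
    refine SetLike.not_le_iff_exists.1 fun hle => ?_
    have := le_antisymm hle hTA
    rw [← this] at hT
    omega
  have hsup : span F {g, h} ⊔ span F {x} = A := by
    refine eq_of_le_of_finrank_le (sup_le hTA ((span_singleton_le_iff_mem _ _).2 hxA)) ?_
    have hlt : span F {g, h} < span F {g, h} ⊔ span F {x} :=
      left_lt_sup.2 fun hle => hxT (hle (mem_span_singleton_self x))
    have : FiniteDimensional F (span F {g, h} ⊔ span F {x} : Submodule F V) :=
      finiteDimensional_of_le (sup_le hTA ((span_singleton_le_iff_mem _ _).2 hxA))
    have := finrank_lt_finrank_of_lt hlt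
    omega
  have key : ∀ z ∈ A, ξ.form z g = 0 → ξ.form z h = 0 → ξ.form z x = 0 → z = 0 := by
    intro z hz h1 h2 h3
    refine hrad z hz fun y hy => ?_
    have : A ≤ ξ.perp z := by
      rw [← hsup]
      refine sup_le (span_le.2 ?_) ((span_singleton_le_iff_mem _ _).2 h3)
      rintro w (rfl | rfl) <;> assumption
    exact this hy
  -- This combination is orthogonal to g, h and x, hence zero. So ξ(g,x) = 0, and g falls into the
  -- radical.
  have hz := key (ξ.form h x • g + (-ξ.form g x) • h)
    (add_mem (smul_mem _ _ hg) (smul_mem _ _ hh))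
    (by simp [hgg, hgh, ξ.form_comm h g]) (by simp [hhh, hgh]) (by simp; ring)
  have hgx := (LinearIndependent.pair_iff.1 hli _ _ hz).2
  exact hg0 (key g hg hgg hgh (neg_eq_zero.1 hgx))

namespace IsPole

variable {e : V} (he : IsPole ξ e)
include he

/-- A regular line off the pole spans a regular plane with each point outside some hyperplane. -/
theorem exists_ne_zero_sup_mem_R [FiniteDimensional F V] {L : Submodule F V}
    (hL : L ∈ ξ.offPoleR 2) :
    ∃ v ≠ 0, (∀ x ∈ L, ξ.form v x = 0) ∧ ∀ y, ξ.form v y ≠ 0 → L ⊔ span F {y} ∈ ξ.R 3 := by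
  obtain ⟨⟨hd, hrad⟩, heL⟩ := hL
  rw [he.b_le_iff] at heL
  have hc : IsCompl L (ξ.form.orthogonal L) :=
    LinearMap.BilinForm.isCompl_orthogonal_of_restrict_nondegenerate ξ.isRefl
      (LinearMap.BilinForm.nondegenerate_restrict_of_disjoint_orthogonal _ ξ.isRefl
        (disjoint_iff.2 hrad))
  have hdec : ∀ y, ∃ l ∈ L, ∃ w, (∀ x ∈ L, ξ.form x w = 0) ∧ l + w = y := by
    intro y
    obtain ⟨l, hl, w, hw, h⟩ := Submodule.mem_sup.1 (hc.sup_eq_top ▸ mem_top (x := y))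
    exact ⟨l, hl, w, hw, h⟩
  -- v is the component of e in L^⊥. For the component w of y one gets ξ(w,w) = ξ(w,e)² = ξ(w,v)² =
  -- ξ(y,v)², so L ⊥ w is regular once this is nonzero.
  obtain ⟨u, hu, v, hv, huv⟩ := hdec e
  refine ⟨v, ?_, fun x hx => by rw [ξ.form_comm]; exact hv x hx, fun y hy => ?_⟩
  · rintro rfl
    exact heL (by rw [← huv]; simpa using hu)
  · obtain ⟨l, hl, w, hw, rfl⟩ := hdec y
    have hvw : ξ.form v w ≠ 0 := by
      rwa [map_add, ξ.form_comm v l, hv l hl, zero_add] at hy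
    have hwe : ξ.form w e ≠ 0 := by
      rwa [← huv, map_add, ξ.form_comm w u, hw u hu, zero_add, ξ.form_comm]
    have hsup : L ⊔ span F {l + w} = L ⊔ span F {w} := by
      apply le_antisymm <;> refine sup_le le_sup_left ((span_singleton_le_iff_mem _ _).2 ?_)
      · exact add_mem (mem_sup_left hl) (mem_sup_right (mem_span_singleton_self w))
      · have := sub_mem (mem_sup_right (S := L) (mem_span_singleton_self (R := F) (l + w)))
          (mem_sup_left (T := span F {l + w}) hl)
        simpa using this
    have hw0 : w ≠ 0 := by rintro rfl; simp at hwe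
    rw [hsup]
    have hww : ξ.form w w ≠ 0 := by rw [he.self_eq]; exact pow_ne_zero _ hwe
    have hdisj : L ⊓ span F {w} = ⊥ := by
      rw [Submodule.eq_bot_iff]
      rintro z ⟨hzL, hzw⟩
      obtain ⟨a, rfl⟩ := mem_span_singleton.1 hzw
      have := hw _ hzL
      simp [hww] at this
      simp [this]
    refine mem_R.2 ⟨?_, fun z hz hzy => ?_⟩
    · have := finrank_sup_add_finrank_inf_eq L (span F {w})
      rw [hdisj, finrank_bot, hd, finrank_span_singleton hw0] at this
      omega
    · obtain ⟨x, hx, z', hz', rfl⟩ := Submodule.mem_sup.1 hz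
      obtain ⟨a, rfl⟩ := mem_span_singleton.1 hz'
      have ha := hzy w (mem_sup_right (mem_span_singleton_self w))
      simp [hw x hx, hww] at ha
      subst ha
      simp only [zero_smul, add_zero] at hzy ⊢
      exact (mem_R.1 ⟨hd, hrad⟩).2 x hx fun y hy => hzy y (mem_sup_left hy)

/-- All points outside two proper subspaces span with a given point other than the pole
a regular affine line off the pole. -/
theorem exists_pair_mem [FiniteDimensional F V] {p : V} (hp : p ∉ span F {e})
    (hV : 3 ≤ finrank F V) :
    ∃ S T : Submodule F V, ¬ ⊤ ≤ S ∧ ¬ ⊤ ≤ T ∧ ∀ y, y ∉ S → y ∉ T →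
      span F {p, y} ∈ ξ.affineR 2 ∩ ξ.offPoleR 2 := by
  have hS : ¬ ⊤ ≤ ξ.perp (ξ.form p e • e - p) := not_top_le_perp (sub_ne_zero.2 fun h =>
    hp (h ▸ smul_mem _ _ (mem_span_singleton_self e)))
  have hpm : ∀ y, p ∈ span F {p, y} := fun y => subset_span (by simp)
  have hym : ∀ y, y ∈ span F {p, y} := fun y => subset_span (by simp)
  have hreg : ∀ y, y ∉ ξ.perp (ξ.form p e • e - p) → span F {p, y} ∈ ξ.R 2 := fun y hy =>
    he.pair_mem_R_iff'.2 hy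
  -- If p is in `H`, avoiding `H` makes the line affine, and regularity then keeps e off it. If p is
  -- not in `H`, the line is affine anyway, and avoiding ⟨p, e⟩ keeps e off it.
  by_cases hpH : ξ.form p e = 0
  · refine ⟨_, ξ.perp e, hS, not_top_le_perp he.ne_zero, fun y hy hyH => ?_⟩
    rw [mem_perp, ξ.form_comm] at hyH
    refine ⟨⟨hreg y hy, fun hle => hyH (he.mem_H.1 (hle (hym y)))⟩, hreg y hy, fun hb => ?_⟩
    obtain ⟨a, c, hac⟩ := mem_span_pair.1 (he.b_le_iff.1 hb)
    have hpy := he.pair_mem_R_iff.1 (hreg y hy)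
    have h0 := hpH
    rw [← hac] at h0
    simp [he.self_eq, hpH] at h0 hpy
    rcases h0 with rfl | h0
    · have ha : a ≠ 0 := by rintro rfl; exact he.ne_zero (by simpa using hac.symm)
      refine hp (mem_span_singleton.2 ⟨a⁻¹, ?_⟩)
      rw [← hac]
      simp [smul_smul, ha]
    · exact hpy h0.symm
  · refine ⟨_, span F {p, e}, hS, fun hle => ?_, fun y hy hyT => ?_⟩
    · have h1 := finrank_mono hle
      rw [finrank_top] at h1
      have h2 : finrank F (span F {p, e}) ≤ 2 := by
        classical
        have := finrank_span_finset_le_card (R := F) ({p, e} : Finset V)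
        have h3 := Finset.card_le_two (a := p) (b := e)
        rw [Set.finrank] at this
        rw [Finset.coe_pair] at this
        omega
      omega
    · refine ⟨⟨hreg y hy, fun hle => hpH (he.mem_H.1 (hle (hpm y)))⟩, hreg y hy, fun hb => ?_⟩
      obtain ⟨a, c, hac⟩ := mem_span_pair.1 (he.b_le_iff.1 hb)
      have hc : c ≠ 0 := by
        rintro rfl
        have ha : a ≠ 0 := by rintro rfl; exact he.ne_zero (by simpa using hac.symm)
        refine hp (mem_span_singleton.2 ⟨a⁻¹, ?_⟩)
        rw [← hac]
        simp [smul_smul, ha]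
      refine hyT (mem_span_pair.2 ⟨-(c⁻¹ * a), c⁻¹, ?_⟩)
      rw [← hac, smul_add, smul_smul, smul_smul, inv_mul_cancel₀ hc]
      module

end IsPole

end PseudoPolarity

/-! ### Relations between lines and their projective meaning. -/

namespace PseudoPolarity

open Submodule Module

variable {F : Type u} [Field F] [CharP F 2] {V : Type v} [AddCommGroup V] [Module F V]

/-- Two subspaces lie in a common regular plane. -/
def Coplanar (ξ : PseudoPolarity F V) (X Y : Submodule F V) : Prop :=
  ∃ A ∈ ξ.R 3, X ≤ A ∧ Y ≤ A

/-- Three pairwise coplanar subspaces without a common regular plane. -/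
def Tripod (ξ : PseudoPolarity F V) (X Y Z : Submodule F V) : Prop :=
  ξ.Coplanar X Y ∧ ξ.Coplanar Y Z ∧ ξ.Coplanar X Z ∧ ¬ ∃ A ∈ ξ.R 3, X ≤ A ∧ Y ≤ A ∧ Z ≤ A

/-- `K` passes through the common point of `X` and `Y`, as witnessed by lines from `P`. -/
def Through (ξ : PseudoPolarity F V) (P : Set (Submodule F V)) (X Y K : Submodule F V) : Prop :=
  ∃ M ∈ P, ∃ M' ∈ P, ξ.Tripod X Y M ∧ ξ.Tripod X M M' ∧ ξ.Tripod M M' K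

/-- The common point of `X` and `Y` is not selfconjugate, as witnessed by lines from `P`. -/
def MeetAffine (ξ : PseudoPolarity F V) (P : Set (Submodule F V)) (X Y : Submodule F V) : Prop :=
  ∃ A ∈ ξ.R 3, ∃ K ∈ P, ξ.Through P X Y K ∧ ¬ K ≤ A ∧ (∃ L ∈ P, L ≤ A ∧ ξ.Through P X Y L) ∧
    ∀ L ∈ P, L ≤ A → ξ.Through P X Y L → ξ.Coplanar K L

/-- The standing assumptions: `e` spans the pole, the field and the dimension are large enough,
and `P` is one of the two sets of lines under consideration. -/
structure IsFrame (ξ : PseudoPolarity F V) (e : V) (P : Set (Submodule F V)) : Prop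
    extends IsPole ξ e where
  four_le_finrank : 4 ≤ finrank F V
  exists_finset : ∃ t : Finset F, (0 : F) ∉ t ∧ 7 ≤ t.card
  points : P = ξ.offPoleR 2 ∨ P = ξ.affineR 2 ∩ ξ.offPoleR 2

variable {ξ : PseudoPolarity F V} {e : V} {P : Set (Submodule F V)}

theorem Coplanar.symm {X Y : Submodule F V} : ξ.Coplanar X Y → ξ.Coplanar Y X :=
  fun ⟨A, hA, hX, hY⟩ => ⟨A, hA, hY, hX⟩

/-- The points `p` and `q` lie on coplanar lines of `P`. -/
def Linked (ξ : PseudoPolarity F V) (P : Set (Submodule F V)) (p q : Submodule F V) : Prop :=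
  ∃ L ∈ P, ∃ L' ∈ P, p ≤ L ∧ q ≤ L' ∧ ξ.Coplanar L L'

theorem Tripod.ne {X Y Z : Submodule F V} (h : ξ.Tripod X Y Z) : X ≠ Y := by
  rintro rfl
  obtain ⟨-, ⟨A, hA, hY, hZ⟩, -, hn⟩ := h
  exact hn ⟨A, hA, hY, hY, hZ⟩

variable [FiniteDimensional F V]

omit [CharP F 2] in
theorem exists_eq_span_of_finrank_eq_one {p : Submodule F V} (hp : finrank F p = 1) :
    ∃ x ≠ 0, p = span F {x} := by
  obtain ⟨x, hx, hx0⟩ := p.ne_bot_iff.1 (by rintro rfl; simp at hp)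
  refine ⟨x, hx0, (eq_of_le_of_finrank_eq ((span_singleton_le_iff_mem _ _).2 hx) ?_).symm⟩
  rw [finrank_span_singleton hx0, hp]

omit [CharP F 2] in
theorem span_pair_eq {L : Submodule F V} (hL : finrank F L = 2) {x y : V} (hx : x ∈ L)
    (hy : y ∈ L) (hx0 : x ≠ 0) (hxy : y ∉ span F {x}) : span F {x, y} = L := by
  refine eq_of_le_of_finrank_eq (span_le.2 ?_) ?_
  · rintro z (rfl | rfl) <;> assumption
  · have hli : LinearIndependent F ![x, y] := (LinearIndependent.pair_iff' hx0).2 fun a ha =>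
      hxy (mem_span_singleton.2 ⟨a, ha⟩)
    have := finrank_span_eq_card hli
    rw [range_pair, Fintype.card_fin] at this
    rw [this, hL]

omit [CharP F 2] [FiniteDimensional F V] in
theorem exists_mem_notMem_span {L : Submodule F V} (hL : finrank F L = 2) (x : V) :
    ∃ y ∈ L, y ∉ span F {x} := by
  refine SetLike.not_le_iff_exists.1 fun hle => ?_
  have := finrank_mono hle
  have := finrank_span_le_card (R := F) ({x} : Set V)
  simp at this
  omega

theorem mem_span_of_perp_le {x y : V} (h : ξ.perp x ≤ ξ.perp y) : y ∈ span F {x} := by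
  have ho : ∀ z, ξ.perp z = ξ.form.orthogonal (span F {z}) := fun z => by
    rw [LinearMap.BilinForm.orthogonal_span_singleton_eq_toLin_ker]; rfl
  rw [ho, ho] at h
  have := LinearMap.BilinForm.orthogonal_le (B := ξ.form) h
  rw [LinearMap.BilinForm.orthogonal_orthogonal ξ.nondegenerate ξ.isRefl,
    LinearMap.BilinForm.orthogonal_orthogonal ξ.nondegenerate ξ.isRefl] at this
  exact this (mem_span_singleton_self y)

theorem exists_ne_zero_orthogonal (h : 4 ≤ finrank F V) (x y z : V) :
    ∃ w ≠ 0, ξ.form x w = 0 ∧ ξ.form y w = 0 ∧ ξ.form z w = 0 := by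
  have h1 := LinearMap.BilinForm.finrank_orthogonal ξ.nondegenerate (span F {x, y, z})
  have h2 : finrank F (span F {x, y, z}) ≤ 3 := by
    have := finrank_range_le_card (R := F) ![x, y, z]
    rwa [Set.finrank, range_triple, Fintype.card_fin] at this
  obtain ⟨w, hw, hw0⟩ := (ξ.form.orthogonal (span F {x, y, z})).ne_bot_iff.1 (by
    intro hb
    rw [hb, finrank_bot] at h1
    omega)
  exact ⟨w, hw0, hw x (subset_span (by simp)), hw y (subset_span (by simp)),
    hw z (subset_span (by simp))⟩

theorem sup_eq_of_le_plane {X Y A : Submodule F V} (hX : finrank F X = 2) (hY : finrank F Y = 2)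
    (hXY : X ≠ Y) (hA : A ∈ ξ.R 3) (hXA : X ≤ A) (hYA : Y ≤ A) : X ⊔ Y = A := by
  refine eq_of_le_of_finrank_le (sup_le hXA hYA) ?_
  have hlt : X < X ⊔ Y := left_lt_sup.2 fun hle =>
    hXY (eq_of_le_of_finrank_eq hle (by omega)).symm
  have := finrank_lt_finrank_of_lt hlt
  have := hA.1
  omega

omit [CharP F 2] in
theorem sup_eq_of_le_line {p q L : Submodule F V} (hp : finrank F p = 1) (hq : finrank F q = 1)
    (hpq : p ≠ q) (hL : finrank F L = 2) (hpL : p ≤ L) (hqL : q ≤ L) : p ⊔ q = L := by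
  refine eq_of_le_of_finrank_le (sup_le hpL hqL) ?_
  have hlt : p < p ⊔ q := left_lt_sup.2 fun hle =>
    hpq (eq_of_le_of_finrank_eq hle (by omega)).symm
  have := finrank_lt_finrank_of_lt hlt
  omega

theorem finrank_inf_of_coplanar {X Y : Submodule F V} (hX : finrank F X = 2)
    (hY : finrank F Y = 2) (hXY : X ≠ Y) (h : ξ.Coplanar X Y) :
    finrank F (X ⊓ Y : Submodule F V) = 1 := by
  obtain ⟨A, hA, hXA, hYA⟩ := h
  have h1 := finrank_sup_add_finrank_inf_eq X Y
  rw [sup_eq_of_le_plane hX hY hXY hA hXA hYA, hA.1] at h1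
  omega

/-- Z is not in the plane A of X and Y, so Z ⊓ A has dimension at most 1. Coplanarity makes both X ⊓
Z and Y ⊓ Z one-dimensional, hence equal to Z ⊓ A, which is therefore X ⊓ Y. -/
theorem Tripod.inf_le {X Y Z : Submodule F V} (hX : finrank F X = 2)
    (hY : finrank F Y = 2) (hZ : finrank F Z = 2) (h : ξ.Tripod X Y Z) : X ⊓ Y ≤ Z := by
  have hXY := h.ne
  obtain ⟨hc, hYZ, hXZ, hn⟩ := h
  have h1 := finrank_inf_of_coplanar hX hY hXY hc
  obtain ⟨A, hA, hXA, hYA⟩ := hc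
  have hZA : ¬ Z ≤ A := fun hZA => hn ⟨A, hA, hXA, hYA, hZA⟩
  have hlt : finrank F (Z ⊓ A : Submodule F V) < 2 := by
    rw [← hZ]
    exact finrank_lt_finrank_of_lt (inf_lt_left.2 hZA)
  have aux : ∀ W : Submodule F V, finrank F W = 2 → W ≤ A → ξ.Coplanar W Z → W ⊓ Z = Z ⊓ A := by
    intro W hW hWA hWZ
    have hne : W ≠ Z := fun h => hZA (h ▸ hWA)
    refine eq_of_le_of_finrank_le (le_inf inf_le_right (inf_le_left.trans hWA)) ?_
    rw [finrank_inf_of_coplanar hW hZ hne hWZ]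
    omega
  have hX' := aux X hX hXA hXZ
  have hY' := aux Y hY hYA hYZ
  have hle : X ⊓ Z ≤ X ⊓ Y := le_inf inf_le_left (by rw [hX', ← hY']; exact inf_le_left)
  have hXne : X ≠ Z := fun h => hZA (h ▸ hXA)
  have := eq_of_le_of_finrank_eq hle (by rw [finrank_inf_of_coplanar hX hZ hXne hXZ, h1])
  rw [← this]
  exact inf_le_right

/-! ### Recovering stars, affine points and regular affine lines from coplanarity. -/

namespace IsFrame

variable (hf : IsFrame ξ e P)
include hf

omit [FiniteDimensional F V] in
theorem points_le {L : Submodule F V} (hL : L ∈ P) : L ∈ ξ.offPoleR 2 := by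
  rcases hf.points with rfl | rfl
  exacts [hL, hL.2]

omit [FiniteDimensional F V] in
theorem finrank_eq {L : Submodule F V} (hL : L ∈ P) : finrank F L = 2 := (hf.points_le hL).1.1

omit [FiniteDimensional F V] in
theorem mem_points {L : Submodule F V} (hL : L ∈ ξ.affineR 2 ∩ ξ.offPoleR 2) : L ∈ P := by
  rcases hf.points with rfl | rfl
  exacts [hL.2, hL]

theorem notMem {L : Submodule F V} (hL : L ∈ P) : e ∉ L := by
  rw [← hf.b_le_iff]
  exact (hf.points_le hL).2

omit [FiniteDimensional F V] in
theorem exists_forall_notMem {l : List (Submodule F V)} (hl : l.length ≤ 7)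
    (h : ∀ S ∈ l, ¬ ⊤ ≤ S) : ∃ y, ∀ S ∈ l, y ∉ S := by
  obtain ⟨t, h0, ht⟩ := hf.exists_finset
  obtain ⟨y, -, hy⟩ := exists_mem_forall_notMem t h0 ⊤ l (hl.trans ht) h
  exact ⟨y, hy⟩

theorem not_top_le {S : Submodule F V} (h : finrank F S ≤ 3) : ¬ ⊤ ≤ S := fun hle => by
  have := finrank_mono hle
  have := hf.four_le_finrank
  rw [finrank_top] at *
  omega

/-- Of the seven subspaces that can be avoided, two are spent on making the line a member of both
point sets; five remain free. -/
theorem exists_line {p : V} (hp : p ∉ span F {e}) {l : List (Submodule F V)} (hl : l.length ≤ 5)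
    (h : ∀ S ∈ l, ¬ ⊤ ≤ S) :
    ∃ y, span F {p, y} ∈ ξ.affineR 2 ∩ ξ.offPoleR 2 ∧ ∀ S ∈ l, y ∉ S := by
  obtain ⟨S, T, hS, hT, hST⟩ := hf.exists_pair_mem hp (by have := hf.four_le_finrank; omega)
  obtain ⟨y, hy⟩ := hf.exists_forall_notMem (l := S :: T :: l) (by simp; omega)
    (by rintro U (_ | ⟨_, _ | ⟨_, hU⟩⟩); exacts [hS, hT, h U hU])
  exact ⟨y, hST y (hy S (by simp)) (hy T (by simp)), fun U hU => hy U (by simp [hU])⟩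

theorem exists_ne_zero_coplanar {L : Submodule F V} (hL : L ∈ P) :
    ∃ v ≠ 0, L ≤ ξ.perp v ∧ ∀ p ∈ L, ∀ y, y ∉ ξ.perp v → ξ.Coplanar L (span F {p, y}) := by
  obtain ⟨v, hv, hvL, h⟩ := hf.exists_ne_zero_sup_mem_R (hf.points_le hL)
  refine ⟨v, hv, fun x hx => mem_perp.2 (hvL x hx), fun p hp y hy => ?_⟩
  refine ⟨_, h y (mem_perp.not.1 hy), le_sup_left, span_le.2 ?_⟩
  rintro x (rfl | rfl)
  · exact mem_sup_left hp
  · exact mem_sup_right (mem_span_singleton_self x)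

/-- Every regular line off the pole lies in a regular plane. -/
theorem coplanar_self {L : Submodule F V} (hL : L ∈ ξ.offPoleR 2) : ξ.Coplanar L L := by
  obtain ⟨v, hv, -, h⟩ := hf.exists_ne_zero_sup_mem_R hL
  obtain ⟨y, -, hy⟩ := SetLike.not_le_iff_exists.1 (not_top_le_perp (ξ := ξ) hv)
  exact ⟨_, h y hy, le_sup_left, le_sup_left⟩

/-- A generic line M through p. The five free subspaces are all used: three for coplanarity with X,
Y and K, one to leave the plane X ⊔ Y, one to leave N. -/
theorem exists_tripod {X Y K N p : Submodule F V} (hX : X ∈ P) (hY : Y ∈ P) (hK : K ∈ P)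
    (hXY : X ≠ Y) (hc : ξ.Coplanar X Y) (hp : finrank F p = 1) (hpX : p ≤ X) (hpY : p ≤ Y)
    (hpK : p ≤ K) (hN : finrank F N ≤ 3) :
    ∃ M ∈ P, p ≤ M ∧ ξ.Tripod X Y M ∧ ξ.Coplanar M K ∧ M ≠ K ∧ ¬ M ≤ N := by
  obtain ⟨p, hp0, rfl⟩ := exists_eq_span_of_finrank_eq_one hp
  rw [span_singleton_le_iff_mem] at hpX hpY hpK
  have hpe : p ∉ span F {e} := by
    intro h
    obtain ⟨a, rfl⟩ := mem_span_singleton.1 h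
    have ha : a ≠ 0 := by rintro rfl; simp at hp0
    exact hf.notMem hX ((X.smul_mem_iff ha).1 hpX)
  obtain ⟨x, hx, -, hxc⟩ := hf.exists_ne_zero_coplanar hX
  obtain ⟨y, hy, -, hyc⟩ := hf.exists_ne_zero_coplanar hY
  obtain ⟨k, hk, hkK, hkc⟩ := hf.exists_ne_zero_coplanar hK
  have hXY3 : finrank F (X ⊔ Y : Submodule F V) ≤ 3 := by
    obtain ⟨A, hA, hXA, hYA⟩ := hc
    rw [sup_eq_of_le_plane (hf.finrank_eq hX) (hf.finrank_eq hY) hXY hA hXA hYA, hA.1]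
  obtain ⟨m, hm, hml⟩ := hf.exists_line hpe
    (l := [ξ.perp x, ξ.perp y, ξ.perp k, X ⊔ Y, N]) (by simp) (by
      simp only [List.mem_cons, List.not_mem_nil, or_false]
      rintro S (rfl | rfl | rfl | rfl | rfl)
      exacts [not_top_le_perp hx, not_top_le_perp hy, not_top_le_perp hk, hf.not_top_le hXY3,
        hf.not_top_le hN])
  simp only [List.forall_mem_cons] at hml
  obtain ⟨h1, h2, h3, h4, h5, -⟩ := hml
  have hmm : m ∈ span F {p, m} := subset_span (by simp)
  refine ⟨_, hf.mem_points hm, span_mono (by simp), ⟨hc, hyc p hpY m h2, hxc p hpX m h1, ?_⟩,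
    (hkc p hpK m h3).symm, fun h => h3 (hkK (h ▸ hmm)), fun h => h5 (h hmm)⟩
  rintro ⟨A, hA, hXA, hYA, hmA⟩
  rw [sup_eq_of_le_plane (hf.finrank_eq hX) (hf.finrank_eq hY) hXY hA hXA hYA] at h4
  exact h4 (hmA hmm)

/-- A single tripod misses lines K in the plane of X and Y, or not coplanar with X or Y. A generic M
coplanar with X, Y and K, then a generic M' off the plane M ⊔ K, bridge the gap. -/
theorem through_iff {X Y K : Submodule F V} (hX : X ∈ P) (hY : Y ∈ P) (hK : K ∈ P) :
    ξ.Through P X Y K ↔ (X ≠ Y ∧ ξ.Coplanar X Y) ∧ X ⊓ Y ≤ K := by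
  constructor
  · rintro ⟨M, hM, M', hM', h1, h2, h3⟩
    refine ⟨⟨h1.ne, h1.1⟩, ?_⟩
    have hle := h1.inf_le (hf.finrank_eq hX) (hf.finrank_eq hY) (hf.finrank_eq hM)
    have hle' := h2.inf_le (hf.finrank_eq hX) (hf.finrank_eq hM) (hf.finrank_eq hM')
    have hle'' := h3.inf_le (hf.finrank_eq hM) (hf.finrank_eq hM') (hf.finrank_eq hK)
    exact (le_inf hle ((le_inf inf_le_left hle).trans hle')).trans hle''
  · rintro ⟨⟨hne, hc⟩, hK'⟩
    have hp := finrank_inf_of_coplanar (hf.finrank_eq hX) (hf.finrank_eq hY) hne hc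
    obtain ⟨M, hM, hpM, h1, hMK, hMne, -⟩ := hf.exists_tripod (N := ⊥) hX hY hK hne hc hp
      inf_le_left inf_le_right hK' (by simp)
    have hXM : X ≠ M := by
      rintro rfl
      obtain ⟨A, hA, hXA, hYA⟩ := h1.1
      exact h1.2.2.2 ⟨A, hA, hXA, hYA, hXA⟩
    obtain ⟨B, hB, hMB, hKB⟩ := hMK
    have hsup := sup_eq_of_le_plane (hf.finrank_eq hM) (hf.finrank_eq hK) hMne hB hMB hKB
    obtain ⟨M', hM', hpM', h2, hMK', -, hB'⟩ := hf.exists_tripod (N := B) hX hM hK hXM h1.2.2.1 hp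
      inf_le_left hpM hK' hB.1.le
    refine ⟨M, hM, M', hM', h1, h2, h2.2.1, hMK', ⟨B, hB, hMB, hKB⟩, ?_⟩
    rintro ⟨A, hA, hMA, hMA', hKA⟩
    refine hB' ?_
    rwa [← hsup, sup_eq_of_le_plane (hf.finrank_eq hM) (hf.finrank_eq hK) hMne hA hMA hKA]

/-- Suppose the common point p is selfconjugate and K = ⟨p, z⟩ with ξ(p,z) = 1. Some y in A has
ξ(p,y) = 1 and ξ(y,e) = ξ(z,e), so y - z is selfconjugate and orthogonal to p. A regular plane
through K and ⟨p, y⟩ then forces y - z into ⟨p⟩, whence K ≤ A. -/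
theorem meetAffine_imp {X Y : Submodule F V} (hX : X ∈ P) (hY : Y ∈ P)
    (h : ξ.MeetAffine P X Y) : X ≠ Y ∧ ξ.Coplanar X Y ∧ X ⊓ Y ∈ ξ.offPoleR 1 := by
  obtain ⟨A, hA, K, hK, hXYK, hKA, ⟨L₀, hL₀, hL₀A, hXYL₀⟩, hcop⟩ := h
  rw [hf.through_iff hX hY hK] at hXYK
  rw [hf.through_iff hX hY hL₀] at hXYL₀
  obtain ⟨⟨hne, hc⟩, hle⟩ := hXYK
  refine ⟨hne, hc, ?_⟩
  have hp := finrank_inf_of_coplanar (hf.finrank_eq hX) (hf.finrank_eq hY) hne hc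
  have heX : e ∉ X ⊓ Y := fun h => hf.notMem hX h.1
  refine ⟨?_, fun hb => heX (hf.b_le_iff.1 hb)⟩
  have hcop' : ∀ L ∈ P, L ≤ A → X ⊓ Y ≤ L → ξ.Coplanar K L := fun L hL hLA hXYL =>
    hcop L hL hLA ((hf.through_iff hX hY hL).2 ⟨⟨hne, hc⟩, hXYL⟩)
  have hpA := hXYL₀.2.trans hL₀A
  generalize X ⊓ Y = p at *
  obtain ⟨p, hp0, rfl⟩ := exists_eq_span_of_finrank_eq_one hp
  rw [span_singleton_le_iff_mem] at hle hpA
  rw [hf.singleton_mem_R_iff]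
  intro hpH
  have hpp : ξ.form p p = 0 := by rw [hf.self_eq, hpH]; simp
  obtain ⟨hA3, hrad⟩ := mem_R.1 hA

  have hscale : ∀ y, ξ.form p y ≠ 0 → ξ.form p ((ξ.form p y)⁻¹ • y) = 1 := fun y hy => by
    simp [hy]
  obtain ⟨z, hzK, hpz⟩ : ∃ z ∈ K, ξ.form p z = 1 := by
    by_contra! hcon
    refine hp0 ((mem_R.1 (hf.points_le hK).1).2 p hle fun y hy => ?_)
    by_contra hy0
    exact hcon _ (K.smul_mem _ hy) (hscale y hy0)
  obtain ⟨a, haA, hpa⟩ : ∃ a ∈ A, ξ.form p a = 1 := by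
    by_contra! hcon
    refine hp0 (hrad p hpA fun y hy => ?_)
    by_contra hy0
    exact hcon _ (A.smul_mem _ hy) (hscale y hy0)
  -- Otherwise A ∩ p^⊥, of dimension at least 2, would contain a selfconjugate vector independent of
  -- p and orthogonal to it.
  obtain ⟨g, hgA, hpg, hgH⟩ : ∃ g ∈ A, ξ.form p g = 0 ∧ ξ.form g e ≠ 0 := by
    by_contra! hcon
    have hd : 2 ≤ finrank F (A ⊓ ξ.perp p : Submodule F V) := by
      have h1 := finrank_sup_add_finrank_inf_eq A (ξ.perp p)
      have h2 := (A ⊔ ξ.perp p).finrank_le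
      have h3 := (ξ.form p).finrank_range_add_finrank_ker
      have h4 := (LinearMap.range (ξ.form p)).finrank_le
      rw [finrank_self] at h4
      change _ + finrank F (ξ.perp p) = _ at h3
      omega
    obtain ⟨g, ⟨hgA, hpg⟩, hgp⟩ : ∃ g ∈ A ⊓ ξ.perp p, g ∉ span F {p} := by
      refine SetLike.not_le_iff_exists.1 fun hle => ?_
      have := finrank_mono hle
      omega
    rw [SetLike.mem_coe, mem_perp] at hpg
    obtain ⟨c, hc⟩ := exists_smul_eq_of_isotropic hA hpA hgA hpp
      (by rw [hf.self_eq, hcon g hgA hpg]; simp) hpg hp0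
    exact hgp (mem_span_singleton.2 ⟨c, hc.symm⟩)
  obtain ⟨y, hyA, hpy, hyz⟩ : ∃ y ∈ A, ξ.form p y = 1 ∧ ξ.form y e = ξ.form z e :=
    ⟨a + ((ξ.form z e - ξ.form a e) / ξ.form g e) • g, A.add_mem haA (A.smul_mem _ hgA),
      by simp [hpa, hpg], by simp [hgH]⟩
  have hp_mem : p ∈ span F {p, y} := subset_span (by simp)
  have hy_mem : y ∈ span F {p, y} := subset_span (by simp)
  have hpK : span F {p, z} = K := span_pair_eq (hf.finrank_eq hK) hle hzK hp0 fun h => by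
    obtain ⟨c, rfl⟩ := mem_span_singleton.1 h
    simp [hpp] at hpz
  have hL : span F {p, y} ∈ P := by
    have hreg : span F {p, y} ∈ ξ.R 2 := hf.pair_mem_R_iff.2 (by simp [hpH, hpy])
    have hoff : span F {p, y} ∈ ξ.offPoleR 2 := by
      refine ⟨hreg, fun hb => heX ?_⟩
      obtain ⟨c, d, hcd⟩ := mem_span_pair.1 (hf.b_le_iff.1 hb)
      have := hpH
      rw [← hcd] at this
      simp [hpp, hpy] at this
      subst this
      exact mem_span_singleton.2 ⟨c, by simpa using hcd⟩
    rcases hf.points with rfl | rfl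
    · exact hoff
    -- Since ξ(y,e) = ξ(z,e), the line ⟨p, y⟩ inherits affineness from K.
    · refine ⟨⟨hreg, fun hH => hK.1.2 ?_⟩, hoff⟩
      rw [← hpK, span_le]
      rintro x (rfl | rfl)
      · exact hf.mem_H.2 hpH
      · exact hf.mem_H.2 (hyz ▸ hf.mem_H.1 (hH hy_mem))
  obtain ⟨B, hB, hKB, hLB⟩ := hcop' _ hL
    (span_le.2 (by rintro x (rfl | rfl) <;> assumption)) (span_mono (by simp))
  obtain ⟨c, hc⟩ := exists_smul_eq_of_isotropic hB (hKB hle) (B.sub_mem (hLB hy_mem) (hKB hzK)) hpp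
    (by rw [hf.self_eq]; simp [hyz]) (by simp [hpz, hpy]) hp0
  refine hKA ?_
  rw [← hpK, span_le]
  rintro x (rfl | rfl)
  · exact hpA
  · have : x = y - c • p := by rw [← hc]; abel
    rw [this]
    exact A.sub_mem hyA (A.smul_mem _ hpA)

theorem exists_eq_span {p : Submodule F V} (hp : p ∈ ξ.offPoleR 1) :
    ∃ x, p = span F {x} ∧ ξ.form x e = 1 ∧ x ≠ 0 ∧ x ∉ span F {e} := by
  obtain ⟨x, hx0, rfl⟩ := exists_eq_span_of_finrank_eq_one hp.1.1
  have hx := hf.singleton_mem_R_iff.1 hp.1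
  have hne : (ξ.form x e)⁻¹ • x ≠ 0 := smul_ne_zero (inv_ne_zero hx) hx0
  refine ⟨(ξ.form x e)⁻¹ • x, (span_singleton_smul_eq (IsUnit.mk0 _ (inv_ne_zero hx)) x).symm,
    by simp [hx], hne, fun h => hp.2 (hf.b_le_iff.2 ?_)⟩
  obtain ⟨a, ha⟩ := mem_span_singleton.1 h
  have ha0 : a ≠ 0 := by rintro rfl; exact hne (by simpa using ha.symm)
  refine mem_span_singleton.2 ⟨a⁻¹ * (ξ.form x e)⁻¹, ?_⟩
  rw [mul_smul, ← ha, smul_smul, inv_mul_cancel₀ ha0, one_smul]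

/-- Take K = ⟨p, x⟩ and A = ⟨p, h, y⟩ with x, h, y in p^⊥ and h selfconjugate, orthogonal to x. A
regular line of A through p is ⟨p, c h + d y⟩ with d ≠ 0, and the Gram determinant of x, c h + d y
is d² times that of x, y. Hence one inequality makes K coplanar with all these lines. -/
theorem exists_meetAffine {p : Submodule F V} (hp : p ∈ ξ.offPoleR 1) :
    ∃ X ∈ P, ∃ Y ∈ P, ξ.MeetAffine P X Y ∧ X ⊓ Y = p := by
  obtain ⟨p, rfl, hpe, hp0, hpE⟩ := hf.exists_eq_span hp
  have hep : e ∉ span F {p} := fun h => hp.2 (hf.b_le_iff.2 h)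
  have hpp : ξ.form p p = 1 := by rw [hf.self_eq, hpe]; simp
  have hline : ∀ x, ξ.form p x = 0 → ξ.form x e ≠ 0 → e ∉ span F {p, x} → span F {p, x} ∈ P := by
    intro x hx hxe hex
    have hreg : span F {p, x} ∈ ξ.R 2 := hf.pair_mem_R_iff.2 (by simpa [hpe, hx] using hxe)
    refine hf.mem_points ⟨⟨hreg, fun h => ?_⟩, hreg, fun h => hex (hf.b_le_iff.1 h)⟩
    rw [hf.mem_H.1 (h (subset_span (by simp : p ∈ ({p, x} : Set V))))] at hpe
    simp at hpe
  obtain ⟨t, ht0, ht7⟩ := hf.exists_finset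
  have hperp : ∀ w, w ∉ span F {p} → ¬ ξ.perp p ≤ ξ.perp w := fun w hw hle =>
    hw (mem_span_of_perp_le hle)
  obtain ⟨x, hxp, hx⟩ := exists_mem_forall_notMem t ht0 (ξ.perp p) [ξ.perp e, span F {p, e}]
    (by simp; omega) (by
      simp only [List.mem_cons, List.not_mem_nil, or_false]
      rintro S (rfl | rfl)
      · exact hperp e hep
      · intro hle
        have h1 := finrank_mono hle
        have h2 := finrank_range_le_card (R := F) ![p, e]
        rw [Set.finrank, range_pair, Fintype.card_fin] at h2
        have h3 := (ξ.form p).finrank_range_add_finrank_ker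
        have h4 := (LinearMap.range (ξ.form p)).finrank_le
        have h5 := hf.four_le_finrank
        rw [finrank_self] at h4
        change _ + finrank F (ξ.perp p) = _ at h3
        omega)
  simp only [List.forall_mem_cons, mem_perp] at hx hxp
  obtain ⟨hxe, hxs, -⟩ := hx
  obtain ⟨h, hh0, hph, heh, hxh⟩ := exists_ne_zero_orthogonal (ξ := ξ) hf.four_le_finrank p e x
  have hhh : ξ.form h h = 0 := by rw [hf.self_eq, ξ.form_comm, heh]; simp
  -- The three avoided subspaces make, in this order, the plane A, the line ⟨p, y⟩ and the line ⟨x,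
  -- y⟩ regular.
  obtain ⟨y, hyp, hy⟩ := exists_mem_forall_notMem t ht0 (ξ.perp p)
    [ξ.perp h, ξ.perp e, ξ.perp (ξ.form x e • e - x)] (by simp; omega) (by
      simp only [List.mem_cons, List.not_mem_nil, or_false]
      rintro S (rfl | rfl | rfl) <;> refine hperp _ ?_
      · intro hmem
        obtain ⟨a, rfl⟩ := mem_span_singleton.1 hmem
        simp [hpp] at hph
        simp [hph] at hh0
      · exact hep
      · intro hmem
        obtain ⟨a, ha⟩ := mem_span_singleton.1 hmem
        refine hxs (mem_span_pair.2 ⟨-a, ξ.form x e, ?_⟩)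
        rw [neg_smul, ha]
        abel)
  simp only [List.forall_mem_cons, mem_perp] at hy hyp
  obtain ⟨hhy, hey, hxy, -⟩ := hy
  rw [ξ.form_comm] at hxe hey
  have hxy' : ξ.form x e * ξ.form y e ≠ ξ.form x y := by
    simpa [sub_eq_zero, ξ.form_comm e y] using hxy
  have hyh : ξ.form y h ≠ 0 := by rwa [ξ.form_comm]
  have hhp : ξ.form h p = 0 := by rwa [ξ.form_comm]
  have hyp' : ξ.form y p = 0 := by rwa [ξ.form_comm]
  have hxp' : ξ.form x p = 0 := by rwa [ξ.form_comm]
  have hA : span F {p, h, y} ∈ ξ.R 3 := by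
    refine span_triple_mem_R fun a b c h1 h2 h3 => ?_
    simp [hpp, hhp, hyp', hph, hhh, hyp, hyh] at h1 h2 h3
    subst h1 h2
    simpa [hhy] using h3
  have hK : span F {p, x} ∈ P := hline x hxp hxe fun hmem => by
    obtain ⟨a, c, hac⟩ := mem_span_pair.1 hmem
    have hc : c ≠ 0 := by
      rintro rfl
      exact hep (mem_span_singleton.2 ⟨a, by simpa using hac⟩)
    refine hxs (mem_span_pair.2 ⟨-(c⁻¹ * a), c⁻¹, ?_⟩)
    rw [← hac, smul_add, smul_smul, smul_smul, inv_mul_cancel₀ hc]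
    module
  have hL : span F {p, y} ∈ P := hline y hyp hey fun hmem => by
    obtain ⟨a, c, hac⟩ := mem_span_pair.1 hmem
    rw [← hac] at heh
    simp [hph, hyh] at heh
    subst heh
    exact hep (mem_span_singleton.2 ⟨a, by simpa using hac⟩)
  have hLA : span F {p, y} ≤ span F {p, h, y} := span_mono (by
    rintro z (rfl | rfl) <;> simp)
  have hKA : ¬ span F {p, x} ≤ span F {p, h, y} := fun hle => by
    obtain ⟨a, c, d, rfl⟩ := mem_span_triple.1 (hle (subset_span (by simp : x ∈ ({p, x} : Set V))))
    simp [hph, hhh, hyh] at hxh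
    subst hxh
    simp [hpp, hph] at hxp
    subst hxp
    simp [ξ.form_comm h e, heh] at hxe
  have hcop : ∀ L ∈ P, L ≤ span F {p, h, y} → p ∈ L → ξ.Coplanar (span F {p, x}) L := by
    intro L hL hLA hpL
    obtain ⟨w, hwL, hwp⟩ := exists_mem_notMem_span (hf.finrank_eq hL) p
    obtain ⟨a, c, d, hw⟩ := mem_span_triple.1 (hLA hwL)
    have hw' : c • h + d • y = w - a • p := by rw [← hw]; abel
    have hw'L : c • h + d • y ∈ L := hw' ▸ L.sub_mem hwL (L.smul_mem _ hpL)
    have hLspan := span_pair_eq (hf.finrank_eq hL) hpL hw'L hp0 fun hmem => hwp (by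
      have := add_mem hmem (smul_mem _ a (mem_span_singleton_self p))
      rwa [hw', sub_add_cancel] at this)
    have hd : d ≠ 0 := by
      rintro rfl
      refine hf.pair_mem_R_iff.1 (hLspan ▸ (hf.points_le hL).1) ?_
      simp [hph, ξ.form_comm h e, heh]
    have hpln : span F {p, x, c • h + d • y} ∈ ξ.R 3 := by
      refine span_triple_mem_R fun α β γ h1 h2 h3 => ?_
      simp [hpp, hxp', hhp, hyp'] at h1
      subst h1
      have := eq_zero_of_gram (s := ξ.form x e) (r := d * ξ.form y e) (t := d * ξ.form x y)
        (a := β) (c := γ) (by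
          rw [mul_left_comm]
          exact fun h => hxy' (mul_left_cancel₀ hd h)) (by
          simpa [hf.self_eq x, ξ.form_comm h x, hxh, ξ.form_comm y x] using h2) (by
          simp [hf.self_eq y, hhh, hxh, ξ.form_comm h y] at h3
          linear_combination h3 - d * γ * c * ξ.form y h * CharTwo.two_eq_zero (R := F))
      exact ⟨rfl, this⟩
    refine ⟨_, hpln, span_mono ?_, ?_⟩
    · rintro z (rfl | rfl) <;> simp
    · rw [← hLspan]
      exact span_mono (by rintro z (rfl | rfl) <;> simp)
  have hne : span F {p, x} ≠ span F {p, y} := fun h => hKA (h ▸ hLA)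
  have hpK : p ∈ span F {p, x} := subset_span (by simp)
  have hpL : p ∈ span F {p, y} := subset_span (by simp)
  have hc := hcop _ hL hLA hpL
  have hinf : span F {p, x} ⊓ span F {p, y} = span F {p} := by
    refine (eq_of_le_of_finrank_eq (le_inf ((span_singleton_le_iff_mem _ _).2 hpK)
      ((span_singleton_le_iff_mem _ _).2 hpL)) ?_).symm
    rw [hp.1.1, finrank_inf_of_coplanar (hf.finrank_eq hK) (hf.finrank_eq hL) hne hc]
  have hthr : ∀ M ∈ P, ξ.Through P (span F {p, x}) (span F {p, y}) M ↔ p ∈ M := fun M hM => by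
    rw [hf.through_iff hK hL hM, hinf, span_singleton_le_iff_mem]
    exact and_iff_right ⟨hne, hc⟩
  refine ⟨_, hK, _, hL, ⟨_, hA, _, hK, (hthr _ hK).2 hpK, hKA, ⟨_, hL, hLA, (hthr _ hL).2 hpL⟩,
    fun M hM hMA hpM => hcop M hM hMA ((hthr M hM).1 hpM)⟩, hinf⟩

/-- With ξ(p,e) = 1, every x in A gives a selfconjugate vector x - ξ(x,e) p orthogonal to e. If e
were a selfconjugate vector of A, this would put A inside ⟨e, p⟩. -/
theorem notMem_plane {A p : Submodule F V} (hA : A ∈ ξ.R 3) (hp : p ∈ ξ.offPoleR 1) (hpA : p ≤ A)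
    (he : ξ.form e e = 0) : e ∉ A := by
  intro heA
  obtain ⟨p, rfl, hpe, hp0, hpE⟩ := hf.exists_eq_span hp
  rw [span_singleton_le_iff_mem] at hpA
  obtain ⟨x, hxA, hx⟩ : ∃ x ∈ A, x ∉ span F {e, p} := by
    refine SetLike.not_le_iff_exists.1 fun hle => ?_
    have h1 := finrank_mono hle
    have h2 := finrank_range_le_card (R := F) ![e, p]
    rw [Set.finrank, range_pair, Fintype.card_fin] at h2
    rw [hA.1] at h1
    omega
  obtain ⟨c, hc⟩ := exists_smul_eq_of_isotropic hA heA
    (A.sub_mem hxA (A.smul_mem (ξ.form x e) hpA)) he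
    (by rw [hf.self_eq]; simp [hpe]) (by rw [ξ.form_comm]; simp [hpe]) hf.ne_zero
  exact hx (mem_span_pair.2 ⟨c, ξ.form x e, by rw [← hc]; abel⟩)

theorem sup_mem_points {p q : Submodule F V} (hp : p ∈ ξ.offPoleR 1) (h : p ⊔ q ∈ ξ.R 2)
    (hb : ¬ ξ.b ≤ p ⊔ q) : p ⊔ q ∈ P := by
  refine hf.mem_points ⟨⟨h, fun hH => ?_⟩, h, hb⟩
  obtain ⟨p, rfl, hpe, -, -⟩ := hf.exists_eq_span hp
  rw [hf.mem_H.1 (hH (mem_sup_left (mem_span_singleton_self p)))] at hpe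
  simp at hpe

theorem exists_points_iff {p q : Submodule F V} (hp : p ∈ ξ.offPoleR 1) (hq : q ∈ ξ.offPoleR 1)
    (hpq : p ≠ q) : (∃ K ∈ P, p ≤ K ∧ q ≤ K) ↔ p ⊔ q ∈ ξ.R 2 ∧ ¬ ξ.b ≤ p ⊔ q := by
  constructor
  · rintro ⟨K, hK, hpK, hqK⟩
    rw [sup_eq_of_le_line hp.1.1 hq.1.1 hpq (hf.finrank_eq hK) hpK hqK]
    exact hf.points_le hK
  · rintro ⟨h, hb⟩
    exact ⟨_, hf.sup_mem_points hp h hb, le_sup_left, le_sup_right⟩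

/-- A regular line joining an affine point to the pole forces the pole to be selfconjugate, and then
no regular plane through an affine point contains e. In all other cases p and q are linked: by their
join if it is regular, otherwise by the lines to a generic third point. -/
theorem linked_iff {p q : Submodule F V} (hp : p ∈ ξ.offPoleR 1) (hq : q ∈ ξ.offPoleR 1)
    (hpq : p ≠ q) : ξ.Linked P p q ↔ ¬ (p ⊔ q ∈ ξ.R 2 ∧ ξ.b ≤ p ⊔ q) := by
  constructor
  · rintro ⟨L, hL, L', hL', hpL, hqL', A, hA, hLA, hLA'⟩ ⟨hreg, hb⟩
    have hpA := hpL.trans hLA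
    have heA : e ∈ A := sup_le hpA (hqL'.trans hLA') (hf.b_le_iff.1 hb)
    refine hf.notMem_plane hA hp hpA ?_ heA
    obtain ⟨p, rfl, hpe, hp0, hpE⟩ := hf.exists_eq_span hp
    have hspan : span F {p, e} = span F {p} ⊔ q :=
      span_pair_eq hreg.1 (mem_sup_left (mem_span_singleton_self p)) (hf.b_le_iff.1 hb) hp0
        fun h => hp.2 (hf.b_le_iff.2 h)
    rw [← hspan, hf.pair_mem_R_iff, hpe, one_mul] at hreg
    -- The scaling of e leaves only the values 0 and 1 for ξ(e,e); regularity of ⟨p, e⟩ excludes 1.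
    have h1 : ξ.form e e * (ξ.form e e - 1) = 0 := by linear_combination -hf.self_eq e
    exact (mul_eq_zero.1 h1).resolve_right (sub_ne_zero.2 hreg)
  · intro h
    by_cases hreg : p ⊔ q ∈ ξ.R 2
    · have hK := hf.sup_mem_points hp hreg fun hb => h ⟨hreg, hb⟩
      exact ⟨_, hK, _, hK, le_sup_left, le_sup_right, hf.coplanar_self (hf.points_le hK)⟩
    · obtain ⟨p, rfl, hpe, hp0, hpE⟩ := hf.exists_eq_span hp
      obtain ⟨q, rfl, hqe, hq0, hqE⟩ := hf.exists_eq_span hq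
      rw [← span_union, Set.singleton_union, hf.pair_mem_R_iff, hpe, hqe, not_not, one_mul] at hreg
      have hpp : ξ.form p p = 1 := by rw [hf.self_eq, hpe]; simp
      have hqq : ξ.form q q = 1 := by rw [hf.self_eq, hqe]; simp
      obtain ⟨S, T, hS, hT, hST⟩ := hf.exists_pair_mem hqE
        (by have := hf.four_le_finrank; omega)
      -- `S` and `T` put ⟨q, y⟩ into `P`; the perp of p - q makes ⟨p, q, y⟩ regular although ⟨p, q⟩
      -- is not.
      obtain ⟨y, hpy, hy⟩ := hf.exists_line hpE (l := [S, T, ξ.perp (p - q)]) (by simp) (by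
        simp only [List.mem_cons, List.not_mem_nil, or_false]
        rintro U (rfl | rfl | rfl)
        exacts [hS, hT, not_top_le_perp (sub_ne_zero.2 fun h => hpq (h ▸ rfl))])
      simp only [List.forall_mem_cons, mem_perp] at hy
      obtain ⟨h1, h2, h3, -⟩ := hy
      refine ⟨_, hf.mem_points hpy, _, hf.mem_points (hST y h1 h2),
        span_mono (by simp), span_mono (by simp), span F {p, q, y}, ?_,
        span_mono (by rintro z (rfl | rfl) <;> simp), span_mono (by rintro z (rfl | rfl) <;> simp)⟩
      rw [map_sub, LinearMap.sub_apply] at h3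
      refine span_triple_mem_R fun a b c e1 e2 e3 => ?_
      simp [hpp, ξ.form_comm q p, ← hreg, ξ.form_comm y p] at e1
      simp [hqq, ← hreg, ξ.form_comm y q] at e2
      have hc : c = 0 := (mul_eq_zero.1 (by linear_combination e1 - e2 :
        c * (ξ.form p y - ξ.form q y) = 0)).resolve_right h3
      subst hc
      simp at e1 e3
      have ha : a = 0 := (mul_eq_zero.1 (by linear_combination e3 - ξ.form q y * e1 :
        a * (ξ.form p y - ξ.form q y) = 0)).resolve_right h3
      subst ha
      simpa using e1

/-- Regularity of the line through two points. -/
theorem sup_mem_R_iff {p q : Submodule F V} (hp : p ∈ ξ.offPoleR 1) (hq : q ∈ ξ.offPoleR 1)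
    (hpq : p ≠ q) : p ⊔ q ∈ ξ.R 2 ↔ (∃ K ∈ P, p ≤ K ∧ q ≤ K) ∨ ¬ ξ.Linked P p q := by
  rw [hf.exists_points_iff hp hq hpq, hf.linked_iff hp hq hpq]
  tauto

/-- Incidence of a point with the regular line through two points. -/
theorem le_sup_iff {p q r : Submodule F V} (hp : p ∈ ξ.offPoleR 1) (hq : q ∈ ξ.offPoleR 1)
    (hr : r ∈ ξ.offPoleR 1) (hpq : p ≠ q) (h : p ⊔ q ∈ ξ.R 2) :
    r ≤ p ⊔ q ↔ (∃ K ∈ P, p ≤ K ∧ q ≤ K ∧ r ≤ K) ∨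
      ¬ ξ.Linked P p q ∧ (p = r ∨ ¬ ξ.Linked P p r) := by
  constructor
  · intro hle
    by_cases hb : ξ.b ≤ p ⊔ q
    · refine Or.inr ⟨fun hl => (hf.linked_iff hp hq hpq).1 hl ⟨h, hb⟩, ?_⟩
      refine or_iff_not_imp_left.2 fun hpr hl => (hf.linked_iff hp hr hpr).1 hl ?_
      rw [sup_eq_of_le_line hp.1.1 hr.1.1 hpr h.1 le_sup_left hle]
      exact ⟨h, hb⟩
    · exact Or.inl ⟨_, hf.sup_mem_points hp h hb, le_sup_left, le_sup_right, hle⟩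
  · rintro (⟨K, hK, hpK, hqK, hrK⟩ | ⟨hl, rfl | hl'⟩)
    · rwa [sup_eq_of_le_line hp.1.1 hq.1.1 hpq (hf.finrank_eq hK) hpK hqK]
    · exact le_sup_left
    · rcases eq_or_ne p r with rfl | hpr
      · exact le_sup_left
      -- Both joins pass through the pole, so each is the line joining p to it.
      rw [hf.linked_iff hp hq hpq, not_not] at hl
      rw [hf.linked_iff hp hr hpr, not_not] at hl'
      have hb1 : finrank F ξ.b = 1 := by rw [hf.b_eq, finrank_span_singleton hf.ne_zero]
      have hpb : p ≠ ξ.b := fun h => hp.2 h.ge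
      rw [← sup_eq_of_le_line hp.1.1 hb1 hpb h.1 le_sup_left hl.2,
        sup_eq_of_le_line hp.1.1 hb1 hpb hl'.1.1 le_sup_left hl'.2]
      exact le_sup_right

end IsFrame

end PseudoPolarity

/-! ### First-order formulas for these relations, uniform in the geometry. -/

namespace PointLineGeometry

/-- A property of tuples of objects, given in all geometries, that is expressed by one formula. -/
def Expressible {α : Type} (Q : ∀ X : PointLineGeometry.{w}, (α → X.Obj) → Prop) : Prop :=
  ∃ φ : incidenceLanguage.Formula α, ∀ (X : PointLineGeometry.{w}) (x : α → X.Obj),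
    φ.Realize x ↔ Q X x

namespace Expressible

variable {α : Type} {Q R : ∀ X : PointLineGeometry.{w}, (α → X.Obj) → Prop}

theorem not (h : Expressible Q) : Expressible fun X x => ¬ Q X x := by
  obtain ⟨φ, hφ⟩ := h
  exact ⟨φ.not, fun X x => by rw [FirstOrder.Language.Formula.realize_not, hφ]⟩

theorem and (h : Expressible Q) (h' : Expressible R) : Expressible fun X x => Q X x ∧ R X x := by
  obtain ⟨φ, hφ⟩ := h
  obtain ⟨ψ, hψ⟩ := h'
  exact ⟨φ ⊓ ψ, fun X x => by rw [FirstOrder.Language.Formula.realize_inf, hφ, hψ]⟩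

theorem or (h : Expressible Q) (h' : Expressible R) : Expressible fun X x => Q X x ∨ R X x := by
  obtain ⟨φ, hφ⟩ := h
  obtain ⟨ψ, hψ⟩ := h'
  exact ⟨φ ⊔ ψ, fun X x => by rw [FirstOrder.Language.Formula.realize_sup, hφ, hψ]⟩

theorem imp (h : Expressible Q) (h' : Expressible R) : Expressible fun X x => Q X x → R X x := by
  obtain ⟨φ, hφ⟩ := h
  obtain ⟨ψ, hψ⟩ := h'
  exact ⟨φ.imp ψ, fun X x => by rw [FirstOrder.Language.Formula.realize_imp, hφ, hψ]⟩

/-- The bound variable becomes the extra coordinate `Sum.inr ()`, so nested formulas are assembled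
by unification. -/
theorem ex {Q : ∀ X : PointLineGeometry.{w}, X.Obj → (α → X.Obj) → Prop}
    (h : Expressible fun X (x : α ⊕ Unit → X.Obj) => Q X (x (Sum.inr ())) fun i => x (Sum.inl i)) :
    Expressible fun X x => ∃ a, Q X a x := by
  obtain ⟨φ, hφ⟩ := h
  refine ⟨φ.iExs Unit, fun X x => ?_⟩
  rw [FirstOrder.Language.Formula.realize_iExs]
  constructor
  · rintro ⟨i, hi⟩
    exact ⟨i (), (hφ _ _).1 hi⟩
  · rintro ⟨a, ha⟩
    exact ⟨fun _ => a, (hφ _ _).2 ha⟩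

theorem all {Q : ∀ X : PointLineGeometry.{w}, X.Obj → (α → X.Obj) → Prop}
    (h : Expressible fun X (x : α ⊕ Unit → X.Obj) => Q X (x (Sum.inr ())) fun i => x (Sum.inl i)) :
    Expressible fun X x => ∀ a, Q X a x := by
  have := (ex (Q := fun X a x => ¬ Q X a x) h.not).not
  simpa only [not_exists, not_not] using this

end Expressible

variable (X : PointLineGeometry.{w})

/-- Incidence, as a relation between objects. -/
def IncObj (a A : X.Obj) : Prop := ∃ (p : X.Pt) (l : X.Ln), a = X.ofPt p ∧ A = X.ofLn l ∧ X.Inc p l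

/-- Two points are incident with a common line. -/
def CopObj (a b : X.Obj) : Prop := ∃ A, X.IncObj a A ∧ X.IncObj b A

/-- Three pairwise collinear points that are not on a common line. -/
def TripodObj (a b c : X.Obj) : Prop :=
  X.CopObj a b ∧ X.CopObj b c ∧ X.CopObj a c ∧ ¬ ∃ A, X.IncObj a A ∧ X.IncObj b A ∧ X.IncObj c A

/-- `k` belongs to the star determined by `a` and `b`. -/
def ThroughObj (a b k : X.Obj) : Prop :=
  ∃ m m', X.TripodObj a b m ∧ X.TripodObj a m m' ∧ X.TripodObj m m' k

/-- `a` and `b` determine the star of an affine point. -/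
def AffineObj (a b : X.Obj) : Prop :=
  ∃ A k, X.ThroughObj a b k ∧ ¬ X.IncObj k A ∧ (∃ l, X.IncObj l A ∧ X.ThroughObj a b l) ∧
    ∀ l, X.IncObj l A → X.ThroughObj a b l → X.CopObj k l

/-- `a, b` and `c, d` determine the same star. -/
def SameObj (a b c d : X.Obj) : Prop := X.ThroughObj a b c ∧ X.ThroughObj a b d

/-- Some members of the stars determined by `a, b` and by `c, d` are collinear. -/
def LinkedObj (a b c d : X.Obj) : Prop :=
  ∃ l l', X.ThroughObj a b l ∧ X.ThroughObj c d l' ∧ X.CopObj l l'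

/-- The stars determined by `a, b` and by `c, d` have a common member. -/
def JoinedObj (a b c d : X.Obj) : Prop := ∃ k, X.ThroughObj a b k ∧ X.ThroughObj c d k

/-- The stars determined by `a, b`, by `c, d` and by `f, g` are collinear. -/
def CollinearObj (a b c d f g : X.Obj) : Prop :=
  (∃ k, X.ThroughObj a b k ∧ X.ThroughObj c d k ∧ X.ThroughObj f g k) ∨
    ¬ X.LinkedObj a b c d ∧ (X.SameObj a b f g ∨ ¬ X.LinkedObj a b f g)

/-- `a, b, c, d` represent an affine point or a regular affine line. -/
def DomObj (a b c d : X.Obj) : Prop :=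
  X.AffineObj a b ∧ X.AffineObj c d ∧
    (X.SameObj a b c d ∨ X.JoinedObj a b c d ∨ ¬ X.LinkedObj a b c d)

/-- `a, b, c, d` and `a', b', c', d'` represent the same object. -/
def EqvObj (a b c d a' b' c' d' : X.Obj) : Prop :=
  X.SameObj a b c d ∧ X.SameObj a' b' c' d' ∧ X.SameObj a b a' b' ∨
    ¬ X.SameObj a b c d ∧ ¬ X.SameObj a' b' c' d' ∧
      X.CollinearObj a b c d a' b' ∧ X.CollinearObj a b c d c' d'

/-- `a, b, c, d` represents a point on the line represented by `a', b', c', d'`. -/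
def IncidentObj (a b c d a' b' c' d' : X.Obj) : Prop :=
  X.SameObj a b c d ∧ ¬ X.SameObj a' b' c' d' ∧ X.CollinearObj a' b' c' d' a b

namespace Expressible

variable {α : Type} (i j k l m n i' j' k' l' : α)

theorem incObj : Expressible.{w} fun X x => X.IncObj (x i) (x j) := by
  refine ⟨FirstOrder.Language.Relations.formula₂ (L := incidenceLanguage) IncidenceRel.inc
    (FirstOrder.Language.Term.var i) (FirstOrder.Language.Term.var j), fun X x => ?_⟩
  exact FirstOrder.Language.Formula.realize_rel₂ (L := incidenceLanguage)

theorem copObj : Expressible.{w} fun X x => X.CopObj (x i) (x j) :=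
  ex ((incObj _ _).and (incObj _ _))

theorem tripodObj : Expressible.{w} fun X x => X.TripodObj (x i) (x j) (x k) :=
  (copObj _ _).and ((copObj _ _).and ((copObj _ _).and
    (ex ((incObj _ _).and ((incObj _ _).and (incObj _ _)))).not))

theorem throughObj : Expressible.{w} fun X x => X.ThroughObj (x i) (x j) (x k) :=
  ex (ex ((tripodObj _ _ _).and ((tripodObj _ _ _).and (tripodObj _ _ _))))

theorem affineObj : Expressible.{w} fun X x => X.AffineObj (x i) (x j) :=
  ex (ex ((throughObj _ _ _).and ((incObj _ _).not.and
    ((ex ((incObj _ _).and (throughObj _ _ _))).and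
      (all ((incObj _ _).imp ((throughObj _ _ _).imp (copObj _ _))))))))

theorem sameObj : Expressible.{w} fun X x => X.SameObj (x i) (x j) (x k) (x l) :=
  (throughObj _ _ _).and (throughObj _ _ _)

theorem linkedObj : Expressible.{w} fun X x => X.LinkedObj (x i) (x j) (x k) (x l) :=
  ex (ex ((throughObj _ _ _).and ((throughObj _ _ _).and (copObj _ _))))

theorem joinedObj : Expressible.{w} fun X x => X.JoinedObj (x i) (x j) (x k) (x l) :=
  ex ((throughObj _ _ _).and (throughObj _ _ _))

theorem collinearObj :
    Expressible.{w} fun X x => X.CollinearObj (x i) (x j) (x k) (x l) (x m) (x n) :=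
  (ex ((throughObj _ _ _).and ((throughObj _ _ _).and (throughObj _ _ _)))).or
    ((linkedObj _ _ _ _).not.and ((sameObj _ _ _ _).or (linkedObj _ _ _ _).not))

theorem domObj : Expressible.{w} fun X x => X.DomObj (x i) (x j) (x k) (x l) :=
  (affineObj _ _).and ((affineObj _ _).and
    ((sameObj _ _ _ _).or ((joinedObj _ _ _ _).or (linkedObj _ _ _ _).not)))

theorem eqvObj : Expressible.{w} fun X x =>
    X.EqvObj (x i) (x j) (x k) (x l) (x i') (x j') (x k') (x l') :=
  ((sameObj _ _ _ _).and ((sameObj _ _ _ _).and (sameObj _ _ _ _))).or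
    ((sameObj _ _ _ _).not.and ((sameObj _ _ _ _).not.and
      ((collinearObj _ _ _ _ _ _).and (collinearObj _ _ _ _ _ _))))

theorem incidentObj : Expressible.{w} fun X x =>
    X.IncidentObj (x i) (x j) (x k) (x l) (x i') (x j') (x k') (x l') :=
  (sameObj _ _ _ _).and ((sameObj _ _ _ _).not.and (collinearObj _ _ _ _ _ _))

end Expressible

/-- The system of formulas: an affine point is represented by two lines through it, taken twice,
and a regular affine line by two pairs of lines that represent two of its affine points. -/
theorem exists_geometryDefinition : ∃ (dom : incidenceLanguage.Formula (Fin 4))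
    (eqv : incidenceLanguage.Formula (Fin 4 ⊕ Fin 4))
    (rel : ∀ {n : ℕ}, incidenceLanguage.Relations n → incidenceLanguage.Formula (Fin n × Fin 4))
    (star : incidenceLanguage.Formula (Fin 4 ⊕ Unit)), ∀ X : PointLineGeometry.{w},
      (∀ x : Fin 4 → X.Obj, dom.Realize x ↔ X.DomObj (x 0) (x 1) (x 2) (x 3)) ∧
      (∀ x y : Fin 4 → X.Obj, eqv.Realize (Sum.elim x y) ↔
        X.EqvObj (x 0) (x 1) (x 2) (x 3) (y 0) (y 1) (y 2) (y 3)) ∧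
      (∀ x : Fin 1 × Fin 4 → X.Obj, (rel IncidenceRel.point).Realize x ↔
        X.SameObj (x (0, 0)) (x (0, 1)) (x (0, 2)) (x (0, 3))) ∧
      (∀ x : Fin 2 × Fin 4 → X.Obj, (rel IncidenceRel.inc).Realize x ↔
        X.IncidentObj (x (0, 0)) (x (0, 1)) (x (0, 2)) (x (0, 3))
          (x (1, 0)) (x (1, 1)) (x (1, 2)) (x (1, 3))) ∧
      (∀ (x : Fin 4 → X.Obj) (L : X.Obj), star.Realize (Sum.elim x fun _ => L) ↔
        X.ThroughObj (x 0) (x 1) L) := by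
  obtain ⟨dom, hdom⟩ := Expressible.domObj.{w} (0 : Fin 4) 1 2 3
  obtain ⟨eqv, heqv⟩ := Expressible.eqvObj.{w} (Sum.inl 0 : Fin 4 ⊕ Fin 4) (Sum.inl 1) (Sum.inl 2)
    (Sum.inl 3) (Sum.inr 0) (Sum.inr 1) (Sum.inr 2) (Sum.inr 3)
  obtain ⟨pt, hpt⟩ := Expressible.sameObj.{w} ((0, 0) : Fin 1 × Fin 4) (0, 1) (0, 2) (0, 3)
  obtain ⟨inc, hinc⟩ := Expressible.incidentObj.{w} ((0, 0) : Fin 2 × Fin 4) (0, 1) (0, 2) (0, 3)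
    (1, 0) (1, 1) (1, 2) (1, 3)
  obtain ⟨star, hstar⟩ := Expressible.throughObj.{w} (Sum.inl 0 : Fin 4 ⊕ Unit) (Sum.inl 1)
    (Sum.inr ())
  exact ⟨dom, eqv, fun {n} (r : IncidenceRel n) => match n, r with
    | _, .point => pt
    | _, .inc => inc, star, fun X => ⟨hdom X, fun x y => heqv X _, hpt X, hinc X,
      fun x L => hstar X _⟩⟩

end PointLineGeometry

/-! ### Translating relations between objects into relations between subspaces. -/

namespace PseudoPolarity

open PointLineGeometry

variable {F : Type u} [Field F] [CharP F 2] {V : Type v} [AddCommGroup V] [Module F V]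
  {ξ : PseudoPolarity F V} {e : V} {P : Set (Submodule F V)}

/-- The geometry with points `P` and the regular planes as its lines. -/
abbrev planeGeometry (ξ : PseudoPolarity F V) (P : Set (Submodule F V)) : PointLineGeometry.{v} :=
  geometryOf P (ξ.R 3)

/-- An object of the geometry is a point, given as a subspace. -/
def IsPt (ξ : PseudoPolarity F V) (P : Set (Submodule F V)) (a : (ξ.planeGeometry P).Obj)
    (L : Submodule F V) : Prop :=
  ∃ h : L ∈ P, a = (ξ.planeGeometry P).ofPt ⟨L, h⟩

theorem IsPt.mem {a : (ξ.planeGeometry P).Obj} {L : Submodule F V} (h : ξ.IsPt P a L) : L ∈ P := h.1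

theorem isPt_mk {L : Submodule F V} (h : L ∈ P) :
    ξ.IsPt P ((ξ.planeGeometry P).ofPt ⟨L, h⟩) L := ⟨h, rfl⟩

theorem IsPt.eq {a : (ξ.planeGeometry P).Obj} {L L' : Submodule F V} (h : ξ.IsPt P a L)
    (h' : ξ.IsPt P a L') : L = L' := by
  obtain ⟨_, rfl⟩ := h
  obtain ⟨_, h⟩ := h'
  exact congrArg Subtype.val (Sum.inl_injective h)

theorem incObj_iff {a : (ξ.planeGeometry P).Obj} {L : Submodule F V} (ha : ξ.IsPt P a L)
    {A : Submodule F V} (hA : A ∈ ξ.R 3) :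
    (ξ.planeGeometry P).IncObj a ((ξ.planeGeometry P).ofLn ⟨A, hA⟩) ↔ L ≤ A := by
  obtain ⟨h, rfl⟩ := ha
  constructor
  · rintro ⟨p, l, hp, hl, hpl⟩
    obtain rfl := Sum.inl_injective hp
    obtain rfl := Sum.inr_injective hl
    exact hpl
  · intro hle
    exact ⟨⟨L, h⟩, ⟨A, hA⟩, rfl, rfl, hle⟩

theorem exists_of_incObj {a A : (ξ.planeGeometry P).Obj} (h : (ξ.planeGeometry P).IncObj a A) :
    (∃ L, ξ.IsPt P a L) ∧ ∃ (B : Submodule F V) (hB : B ∈ ξ.R 3),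
      A = (ξ.planeGeometry P).ofLn ⟨B, hB⟩ := by
  obtain ⟨p, l, rfl, rfl, -⟩ := h
  exact ⟨⟨p.1, p.2, rfl⟩, l.1, l.2, rfl⟩

theorem copObj_iff {a b : (ξ.planeGeometry P).Obj} {X Y : Submodule F V} (ha : ξ.IsPt P a X)
    (hb : ξ.IsPt P b Y) : (ξ.planeGeometry P).CopObj a b ↔ ξ.Coplanar X Y := by
  constructor
  · rintro ⟨A, h1, h2⟩
    obtain ⟨-, B, hB, rfl⟩ := exists_of_incObj h1
    exact ⟨B, hB, (incObj_iff ha hB).1 h1, (incObj_iff hb hB).1 h2⟩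
  · rintro ⟨B, hB, h1, h2⟩
    exact ⟨_, (incObj_iff ha hB).2 h1, (incObj_iff hb hB).2 h2⟩

theorem tripodObj_iff {a b c : (ξ.planeGeometry P).Obj} {X Y Z : Submodule F V}
    (ha : ξ.IsPt P a X) (hb : ξ.IsPt P b Y) (hc : ξ.IsPt P c Z) :
    (ξ.planeGeometry P).TripodObj a b c ↔ ξ.Tripod X Y Z := by
  rw [TripodObj, Tripod, copObj_iff ha hb, copObj_iff hb hc, copObj_iff ha hc]
  refine and_congr_right fun _ => and_congr_right fun _ => and_congr_right fun _ => not_congr ?_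
  constructor
  · rintro ⟨A, h1, h2, h3⟩
    obtain ⟨-, B, hB, rfl⟩ := exists_of_incObj h1
    exact ⟨B, hB, (incObj_iff ha hB).1 h1, (incObj_iff hb hB).1 h2, (incObj_iff hc hB).1 h3⟩
  · rintro ⟨B, hB, h1, h2, h3⟩
    exact ⟨_, (incObj_iff ha hB).2 h1, (incObj_iff hb hB).2 h2, (incObj_iff hc hB).2 h3⟩

theorem exists_of_tripodObj {a b c : (ξ.planeGeometry P).Obj}
    (h : (ξ.planeGeometry P).TripodObj a b c) :
    (∃ X, ξ.IsPt P a X) ∧ (∃ Y, ξ.IsPt P b Y) ∧ ∃ Z, ξ.IsPt P c Z := by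
  obtain ⟨⟨A, h1, h2⟩, ⟨B, -, h3⟩, -, -⟩ := h
  exact ⟨(exists_of_incObj h1).1, (exists_of_incObj h2).1, (exists_of_incObj h3).1⟩

theorem throughObj_iff {a b c : (ξ.planeGeometry P).Obj} {X Y Z : Submodule F V}
    (ha : ξ.IsPt P a X) (hb : ξ.IsPt P b Y) (hc : ξ.IsPt P c Z) :
    (ξ.planeGeometry P).ThroughObj a b c ↔ ξ.Through P X Y Z := by
  constructor
  · rintro ⟨m, m', h1, h2, h3⟩
    obtain ⟨⟨M, hM⟩, ⟨M', hM'⟩, -⟩ := exists_of_tripodObj h3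
    exact ⟨M, hM.mem, M', hM'.mem, (tripodObj_iff ha hb hM).1 h1, (tripodObj_iff ha hM hM').1 h2,
      (tripodObj_iff hM hM' hc).1 h3⟩
  · rintro ⟨M, hM, M', hM', h1, h2, h3⟩
    exact ⟨_, _, (tripodObj_iff ha hb (isPt_mk hM)).2 h1,
      (tripodObj_iff ha (isPt_mk hM) (isPt_mk hM')).2 h2,
      (tripodObj_iff (isPt_mk hM) (isPt_mk hM') hc).2 h3⟩

theorem exists_of_throughObj {a b c : (ξ.planeGeometry P).Obj}
    (h : (ξ.planeGeometry P).ThroughObj a b c) :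
    (∃ X, ξ.IsPt P a X) ∧ (∃ Y, ξ.IsPt P b Y) ∧ ∃ Z, ξ.IsPt P c Z := by
  obtain ⟨m, m', h1, -, h3⟩ := h
  exact ⟨(exists_of_tripodObj h1).1, (exists_of_tripodObj h1).2.1, (exists_of_tripodObj h3).2.2⟩

/-- `a` and `b` are two lines that represent the point `p`. -/
def Represents (ξ : PseudoPolarity F V) (P : Set (Submodule F V))
    (a b : (ξ.planeGeometry P).Obj) (p : Submodule F V) : Prop :=
  ∃ X Y, ξ.IsPt P a X ∧ ξ.IsPt P b Y ∧ ξ.MeetAffine P X Y ∧ X ⊓ Y = p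

theorem affineObj_iff {a b : (ξ.planeGeometry P).Obj} :
    (ξ.planeGeometry P).AffineObj a b ↔ ∃ p, ξ.Represents P a b p := by
  constructor
  · rintro ⟨A, k, hk, hkA, ⟨l, hlA, hl⟩, hall⟩
    obtain ⟨⟨X, hX⟩, ⟨Y, hY⟩, K, hK⟩ := exists_of_throughObj hk
    obtain ⟨⟨L, hL⟩, B, hB, rfl⟩ := exists_of_incObj hlA
    refine ⟨_, X, Y, hX, hY, ⟨B, hB, K, hK.mem, (throughObj_iff hX hY hK).1 hk,
      (incObj_iff hK hB).not.1 hkA, ⟨L, hL.mem, (incObj_iff hL hB).1 hlA,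
      (throughObj_iff hX hY hL).1 hl⟩, fun M hM hMB hXYM => ?_⟩, rfl⟩
    exact (copObj_iff hK (isPt_mk hM)).1 (hall _ ((incObj_iff (isPt_mk hM) hB).2 hMB)
      ((throughObj_iff hX hY (isPt_mk hM)).2 hXYM))
  · rintro ⟨_, X, Y, hX, hY, ⟨B, hB, K, hK, h1, h2, ⟨L, hL, h3, h4⟩, h5⟩, -⟩
    refine ⟨_, _, (throughObj_iff hX hY (isPt_mk hK)).2 h1, (incObj_iff (isPt_mk hK) hB).not.2 h2,
      ⟨_, (incObj_iff (isPt_mk hL) hB).2 h3, (throughObj_iff hX hY (isPt_mk hL)).2 h4⟩,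
      fun l hlB hl => ?_⟩
    obtain ⟨M, hM⟩ := (exists_of_incObj hlB).1
    exact (copObj_iff (isPt_mk hK) hM).2 (h5 M hM.mem ((incObj_iff hM hB).1 hlB)
      ((throughObj_iff hX hY hM).1 hl))

section Represents

variable [FiniteDimensional F V] (hf : IsFrame ξ e P)
include hf

variable {a b c d f g : (ξ.planeGeometry P).Obj} {p q r : Submodule F V}
  (hp : ξ.Represents P a b p) (hq : ξ.Represents P c d q) (hr : ξ.Represents P f g r)

include hp

theorem Represents.mem : p ∈ ξ.offPoleR 1 := by
  obtain ⟨X, Y, hX, hY, hXY, rfl⟩ := hp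
  exact (hf.meetAffine_imp hX.mem hY.mem hXY).2.2

theorem Represents.throughObj_iff {k : (ξ.planeGeometry P).Obj} {K : Submodule F V}
    (hk : ξ.IsPt P k K) : (ξ.planeGeometry P).ThroughObj a b k ↔ p ≤ K := by
  obtain ⟨X, Y, hX, hY, hXY, rfl⟩ := hp
  have := hf.meetAffine_imp hX.mem hY.mem hXY
  rw [PseudoPolarity.throughObj_iff hX hY hk, hf.through_iff hX.mem hY.mem hk.mem]
  exact and_iff_right ⟨this.1, this.2.1⟩

include hq

theorem Represents.sameObj_iff : (ξ.planeGeometry P).SameObj a b c d ↔ p = q := by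
  have hpm := hp.mem hf
  have hqm := hq.mem hf
  obtain ⟨X, Y, hX, hY, -, rfl⟩ := hq
  rw [SameObj, hp.throughObj_iff hf hX, hp.throughObj_iff hf hY, ← le_inf_iff]
  exact ⟨fun h => Submodule.eq_of_le_of_finrank_eq h (hpm.1.1.trans hqm.1.1.symm), fun h => h.le⟩

theorem Represents.linkedObj_iff : (ξ.planeGeometry P).LinkedObj a b c d ↔ ξ.Linked P p q := by
  constructor
  · rintro ⟨l, l', h1, h2, h3⟩
    obtain ⟨-, -, L, hL⟩ := exists_of_throughObj h1
    obtain ⟨-, -, L', hL'⟩ := exists_of_throughObj h2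
    exact ⟨L, hL.mem, L', hL'.mem, (hp.throughObj_iff hf hL).1 h1, (hq.throughObj_iff hf hL').1 h2,
      (copObj_iff hL hL').1 h3⟩
  · rintro ⟨L, hL, L', hL', h1, h2, h3⟩
    exact ⟨_, _, (hp.throughObj_iff hf (isPt_mk hL)).2 h1, (hq.throughObj_iff hf (isPt_mk hL')).2 h2,
      (copObj_iff (isPt_mk hL) (isPt_mk hL')).2 h3⟩

theorem Represents.joinedObj_iff :
    (ξ.planeGeometry P).JoinedObj a b c d ↔ ∃ K ∈ P, p ≤ K ∧ q ≤ K := by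
  constructor
  · rintro ⟨k, h1, h2⟩
    obtain ⟨-, -, K, hK⟩ := exists_of_throughObj h1
    exact ⟨K, hK.mem, (hp.throughObj_iff hf hK).1 h1, (hq.throughObj_iff hf hK).1 h2⟩
  · rintro ⟨K, hK, h1, h2⟩
    exact ⟨_, (hp.throughObj_iff hf (isPt_mk hK)).2 h1, (hq.throughObj_iff hf (isPt_mk hK)).2 h2⟩

include hr

theorem Represents.collinearObj_iff (hpq : p ≠ q) (h : p ⊔ q ∈ ξ.R 2) :
    (ξ.planeGeometry P).CollinearObj a b c d f g ↔ r ≤ p ⊔ q := by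
  rw [hf.le_sup_iff (hp.mem hf) (hq.mem hf) (hr.mem hf) hpq h, CollinearObj,
    hp.linkedObj_iff hf hq, hp.linkedObj_iff hf hr, hp.sameObj_iff hf hr]
  refine or_congr_left ?_
  constructor
  · rintro ⟨k, h1, h2, h3⟩
    obtain ⟨-, -, K, hK⟩ := exists_of_throughObj h1
    exact ⟨K, hK.mem, (hp.throughObj_iff hf hK).1 h1, (hq.throughObj_iff hf hK).1 h2,
      (hr.throughObj_iff hf hK).1 h3⟩
  · rintro ⟨K, hK, h1, h2, h3⟩
    exact ⟨_, (hp.throughObj_iff hf (isPt_mk hK)).2 h1, (hq.throughObj_iff hf (isPt_mk hK)).2 h2,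
      (hr.throughObj_iff hf (isPt_mk hK)).2 h3⟩

end Represents

end PseudoPolarity

/-! ### Quadruples of lines as codes for the objects of `B₁`. -/

namespace PseudoPolarity

open PointLineGeometry Submodule Module

variable {F : Type u} [Field F] [CharP F 2] {V : Type v} [AddCommGroup V] [Module F V]
  {ξ : PseudoPolarity F V} {e : V} {P : Set (Submodule F V)}

theorem Represents.eq {a b : (ξ.planeGeometry P).Obj} {p q : Submodule F V}
    (hp : ξ.Represents P a b p) (hq : ξ.Represents P a b q) : p = q := by
  obtain ⟨X, Y, hX, hY, -, rfl⟩ := hp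
  obtain ⟨X', Y', hX', hY', -, rfl⟩ := hq
  rw [hX.eq hX', hY.eq hY']

/-- The object represented by four lines. -/
def RepresentsObj (ξ : PseudoPolarity F V) (P : Set (Submodule F V))
    (x : Fin 4 → (ξ.planeGeometry P).Obj) (o : ξ.B₁.Obj) : Prop :=
  ∃ p q : ξ.B₁.Pt, ξ.Represents P (x 0) (x 1) p.1 ∧ ξ.Represents P (x 2) (x 3) q.1 ∧
    (p = q ∧ o = ξ.B₁.ofPt p ∨
      p.1 ≠ q.1 ∧ ∃ l : ξ.B₁.Ln, l.1 = p.1 ⊔ q.1 ∧ o = ξ.B₁.ofLn l)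

theorem RepresentsObj.eq {x : Fin 4 → (ξ.planeGeometry P).Obj} {o o' : ξ.B₁.Obj}
    (h : ξ.RepresentsObj P x o) (h' : ξ.RepresentsObj P x o') : o = o' := by
  obtain ⟨p, q, hp, hq, h⟩ := h
  obtain ⟨p', q', hp', hq', h'⟩ := h'
  obtain rfl := Subtype.ext (hp.eq hp')
  obtain rfl := Subtype.ext (hq.eq hq')
  rcases h with ⟨rfl, rfl⟩ | ⟨hne, l, hl, rfl⟩ <;> rcases h' with ⟨he, rfl⟩ | ⟨hne', l', hl', rfl⟩
  · rfl
  · exact absurd rfl hne'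
  · exact absurd (congrArg Subtype.val he) hne
  · rw [Subtype.ext (hl.trans hl'.symm)]

theorem ofPt_ne_ofLn (X : PointLineGeometry.{w}) (p : X.Pt) (l : X.Ln) : X.ofPt p ≠ X.ofLn l :=
  Sum.inl_ne_inr

namespace IsFrame

variable [FiniteDimensional F V] (hf : IsFrame ξ e P)
include hf

theorem exists_sup_eq {l : Submodule F V} (hl : l ∈ ξ.affineR 2) :
    ∃ p ∈ ξ.offPoleR 1, ∃ q ∈ ξ.offPoleR 1, p ≠ q ∧ p ⊔ q = l := by
  obtain ⟨⟨hd, -⟩, hlH⟩ := hl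
  obtain ⟨t, ht0, ht7⟩ := hf.exists_finset
  have h1 : ¬ l ≤ ξ.perp e := fun hle => hlH fun x hx => hf.mem_H.2 (by
    rw [ξ.form_comm]
    exact hle hx)
  have h2 : ∀ x, ¬ l ≤ span F {x} := fun x => by
    obtain ⟨y, hy, hyx⟩ := exists_mem_notMem_span hd x
    exact fun hle => hyx (hle hy)
  have hpt : ∀ x, x ∉ ξ.perp e → x ∉ span F {e} → span F {x} ∈ ξ.offPoleR 1 := by
    intro x hx hxe
    rw [mem_perp, ξ.form_comm] at hx
    refine ⟨hf.singleton_mem_R_iff.2 hx, fun hb => hxe ?_⟩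
    obtain ⟨a, ha⟩ := mem_span_singleton.1 (hf.b_le_iff.1 hb)
    have ha0 : a ≠ 0 := by
      rintro rfl
      exact hf.ne_zero (by simpa using ha.symm)
    exact mem_span_singleton.2 ⟨a⁻¹, by rw [← ha, smul_smul, inv_mul_cancel₀ ha0, one_smul]⟩
  obtain ⟨x, hxl, hx⟩ := exists_mem_forall_notMem t ht0 l [ξ.perp e, span F {e}]
    (by simp; omega) (by simp [h1, h2, -span_singleton_le_iff_mem])
  obtain ⟨y, hyl, hy⟩ := exists_mem_forall_notMem t ht0 l [ξ.perp e, span F {e}, span F {x}]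
    (by simp; omega) (by simp [h1, h2, -span_singleton_le_iff_mem])
  simp only [List.forall_mem_cons] at hx hy
  have hxp := hpt x hx.1 hx.2.1
  have hyp := hpt y hy.1 hy.2.1
  have hne : span F {x} ≠ span F {y} := fun h => hy.2.2.1 (h ▸ mem_span_singleton_self y)
  exact ⟨_, hxp, _, hyp, hne, sup_eq_of_le_line hxp.1.1 hyp.1.1 hne hd
    ((span_singleton_le_iff_mem _ _).2 hxl) ((span_singleton_le_iff_mem _ _).2 hyl)⟩

theorem exists_represents {p : Submodule F V} (hp : p ∈ ξ.offPoleR 1) :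
    ∃ a b, ξ.Represents P a b p := by
  obtain ⟨X, hX, Y, hY, hXY, h⟩ := hf.exists_meetAffine hp
  exact ⟨_, _, X, Y, isPt_mk hX, isPt_mk hY, hXY, h⟩

/-- For p ≠ q a common line covers regular joins off the pole, and failure of linkage covers regular
joins through it. -/
theorem domObj_iff {a b c d : (ξ.planeGeometry P).Obj} : (ξ.planeGeometry P).DomObj a b c d ↔
    ∃ p q, ξ.Represents P a b p ∧ ξ.Represents P c d q ∧ (p ≠ q → p ⊔ q ∈ ξ.R 2) := by
  rw [DomObj, affineObj_iff, affineObj_iff]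
  have key : ∀ p q, ξ.Represents P a b p → ξ.Represents P c d q →
      (((ξ.planeGeometry P).SameObj a b c d ∨ (ξ.planeGeometry P).JoinedObj a b c d ∨
        ¬ (ξ.planeGeometry P).LinkedObj a b c d) ↔ (p ≠ q → p ⊔ q ∈ ξ.R 2)) := by
    intro p q hp hq
    rw [hp.sameObj_iff hf hq, hp.joinedObj_iff hf hq, hp.linkedObj_iff hf hq,
      ← or_iff_not_imp_left]
    by_cases hpq : p = q
    · simp [hpq]
    · rw [hf.sup_mem_R_iff (hp.mem hf) (hq.mem hf) hpq]
  constructor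
  · rintro ⟨⟨p, hp⟩, ⟨q, hq⟩, h⟩
    exact ⟨p, q, hp, hq, (key p q hp hq).1 h⟩
  · rintro ⟨p, q, hp, hq, h⟩
    exact ⟨⟨p, hp⟩, ⟨q, hq⟩, (key p q hp hq).2 h⟩

theorem exists_representsObj {x : Fin 4 → (ξ.planeGeometry P).Obj}
    (h : (ξ.planeGeometry P).DomObj (x 0) (x 1) (x 2) (x 3)) : ∃ o, ξ.RepresentsObj P x o := by
  obtain ⟨p, q, hp, hq, hpq⟩ := hf.domObj_iff.1 h
  have hpm := hp.mem hf
  by_cases heq : p = q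
  · subst heq
    exact ⟨_, ⟨p, hpm⟩, ⟨p, hpm⟩, hp, hq, Or.inl ⟨rfl, rfl⟩⟩
  · have haff : p ⊔ q ∈ ξ.affineR 2 := by
      refine ⟨hpq heq, fun hH => ?_⟩
      obtain ⟨p, rfl, hpe, -, -⟩ := hf.exists_eq_span hpm
      rw [hf.mem_H.1 (hH (mem_sup_left (mem_span_singleton_self p)))] at hpe
      simp at hpe
    exact ⟨_, ⟨p, hpm⟩, ⟨q, hq.mem hf⟩, hp, hq, Or.inr ⟨heq, ⟨_, haff⟩, rfl, rfl⟩⟩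

theorem exists_tuple (o : ξ.B₁.Obj) : ∃ x : Fin 4 → (ξ.planeGeometry P).Obj,
    (ξ.planeGeometry P).DomObj (x 0) (x 1) (x 2) (x 3) ∧ ξ.RepresentsObj P x o := by
  rcases o with p | l
  · obtain ⟨a, b, hp⟩ := hf.exists_represents p.2
    exact ⟨![a, b, a, b], hf.domObj_iff.2 ⟨p.1, p.1, hp, hp, fun h => absurd rfl h⟩,
      p, p, hp, hp, Or.inl ⟨rfl, rfl⟩⟩
  · obtain ⟨p, hp, q, hq, hne, hl⟩ := hf.exists_sup_eq l.2
    obtain ⟨a, b, hab⟩ := hf.exists_represents hp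
    obtain ⟨c, d, hcd⟩ := hf.exists_represents hq
    exact ⟨![a, b, c, d], hf.domObj_iff.2 ⟨p, q, hab, hcd, fun _ => hl ▸ l.2.1⟩,
      ⟨p, hp⟩, ⟨q, hq⟩, hab, hcd, Or.inr ⟨hne, l, hl.symm, rfl⟩⟩

variable {x y : Fin 4 → (ξ.planeGeometry P).Obj} {o o' : ξ.B₁.Obj}

theorem sameObj_iff_exists (h : ξ.RepresentsObj P x o) :
    (ξ.planeGeometry P).SameObj (x 0) (x 1) (x 2) (x 3) ↔ ∃ p, o = ξ.B₁.ofPt p := by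
  obtain ⟨p, q, hp, hq, h⟩ := h
  rw [hp.sameObj_iff hf hq]
  rcases h with ⟨rfl, rfl⟩ | ⟨hne, l, hl, rfl⟩
  · simp
  · exact iff_of_false hne fun ⟨p, hp⟩ => ofPt_ne_ofLn _ _ _ hp.symm

theorem collinearObj_iff_le {l : ξ.B₁.Ln} (h : ξ.RepresentsObj P x (ξ.B₁.ofLn l))
    {f g : (ξ.planeGeometry P).Obj} {r : Submodule F V} (hr : ξ.Represents P f g r) :
    (ξ.planeGeometry P).CollinearObj (x 0) (x 1) (x 2) (x 3) f g ↔ r ≤ l.1 := by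
  obtain ⟨p, q, hp, hq, ⟨-, h⟩ | ⟨hne, l', hl, h⟩⟩ := h
  · exact absurd h.symm (ofPt_ne_ofLn _ _ _)
  · obtain rfl := Sum.inr_injective h
    rw [hp.collinearObj_iff hf hq hr hne (hl ▸ l.2.1), hl]

theorem eqvObj_iff (hx : ξ.RepresentsObj P x o) (hy : ξ.RepresentsObj P y o') :
    (ξ.planeGeometry P).EqvObj (x 0) (x 1) (x 2) (x 3) (y 0) (y 1) (y 2) (y 3) ↔ o = o' := by
  rw [EqvObj, hf.sameObj_iff_exists hx, hf.sameObj_iff_exists hy]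
  rcases o with p | l <;> rcases o' with p' | l'
  · obtain ⟨p, q, hp, hq, ⟨rfl, h⟩ | ⟨-, _, -, h⟩⟩ := hx
    swap; · exact absurd h Sum.inl_ne_inr
    obtain rfl := Sum.inl_injective h
    obtain ⟨p', q', hp', hq', ⟨rfl, h⟩ | ⟨-, _, -, h⟩⟩ := hy
    swap; · exact absurd h Sum.inl_ne_inr
    obtain rfl := Sum.inl_injective h
    rw [hp.sameObj_iff hf hp']
    constructor
    · rintro (⟨-, -, h⟩ | ⟨h, -⟩)
      · rw [Subtype.ext h]
      · exact absurd ⟨_, rfl⟩ h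
    · intro h
      exact Or.inl ⟨⟨_, rfl⟩, ⟨_, rfl⟩, congrArg Subtype.val (Sum.inl_injective h)⟩
  · refine iff_of_false ?_ Sum.inl_ne_inr
    rintro (⟨-, ⟨_, h⟩, -⟩ | ⟨h, -⟩)
    · exact Sum.inr_ne_inl h
    · exact h ⟨_, rfl⟩
  · refine iff_of_false ?_ Sum.inr_ne_inl
    rintro (⟨⟨_, h⟩, -⟩ | ⟨-, h, -⟩)
    · exact Sum.inr_ne_inl h
    · exact h ⟨_, rfl⟩
  · have hno : ∀ l : ξ.B₁.Ln, ¬ ∃ p, (Sum.inr l : ξ.B₁.Obj) = ξ.B₁.ofPt p :=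
      fun l ⟨p, h⟩ => Sum.inr_ne_inl h
    obtain ⟨p', q', hp', hq', ⟨-, h⟩ | ⟨hne, l'', hl, h⟩⟩ := hy
    · exact absurd h Sum.inr_ne_inl
    obtain rfl := Sum.inr_injective h
    rw [hf.collinearObj_iff_le hx hp', hf.collinearObj_iff_le hx hq']
    -- Two lines agree once the first contains both points that code the second.
    have : (p'.1 ≤ l.1 ∧ q'.1 ≤ l.1) ↔ l' = l := by
      rw [← sup_le_iff, ← hl]
      exact ⟨fun h => Subtype.ext (eq_of_le_of_finrank_eq h (l'.2.1.1.trans l.2.1.1.symm)),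
        fun h => h ▸ le_rfl⟩
    rw [this]
    constructor
    · rintro (⟨h, -⟩ | ⟨-, -, rfl⟩)
      · exact absurd h (hno l)
      · rfl
    · intro h
      exact Or.inr ⟨hno l, hno l', (Sum.inr_injective h).symm⟩

theorem incidentObj_iff (hx : ξ.RepresentsObj P x o) (hy : ξ.RepresentsObj P y o') :
    (ξ.planeGeometry P).IncidentObj (x 0) (x 1) (x 2) (x 3) (y 0) (y 1) (y 2) (y 3) ↔
      ∃ (p : ξ.B₁.Pt) (l : ξ.B₁.Ln), o = ξ.B₁.ofPt p ∧ o' = ξ.B₁.ofLn l ∧ ξ.B₁.Inc p l := by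
  rw [IncidentObj, hf.sameObj_iff_exists hx, hf.sameObj_iff_exists hy]
  constructor
  · rintro ⟨⟨p, rfl⟩, hno, h⟩
    rcases o' with p' | l
    · exact absurd ⟨_, rfl⟩ hno
    obtain ⟨p', q, hp, -, ⟨rfl, h'⟩ | ⟨-, _, -, h'⟩⟩ := hx
    · obtain rfl := Sum.inl_injective h'
      exact ⟨p, l, rfl, rfl, (hf.collinearObj_iff_le hy hp).1 h⟩
    · exact absurd h' Sum.inl_ne_inr
  · rintro ⟨p, l, rfl, rfl, hpl⟩
    refine ⟨⟨p, rfl⟩, fun ⟨p, h⟩ => Sum.inr_ne_inl h, ?_⟩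
    obtain ⟨p', q, hp, -, ⟨rfl, h'⟩ | ⟨-, _, -, h'⟩⟩ := hx
    · obtain rfl := Sum.inl_injective h'
      exact (hf.collinearObj_iff_le hy hp).2 hpl
    · exact absurd h' Sum.inl_ne_inr

theorem throughObj_iff_liesOn {p : ξ.B₁.Pt} (hx : ξ.RepresentsObj P x (ξ.B₁.ofPt p))
    (L : (ξ.planeGeometry P).Pt) :
    (ξ.planeGeometry P).ThroughObj (x 0) (x 1) ((ξ.planeGeometry P).ofPt L) ↔ p.1 ≤ L.1 := by
  obtain ⟨p', q, hp, -, ⟨rfl, h'⟩ | ⟨-, _, -, h'⟩⟩ := hx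
  · obtain rfl := Sum.inl_injective h'
    exact hp.throughObj_iff hf (isPt_mk L.2)
  · exact absurd h' Sum.inl_ne_inr

end IsFrame

/-- One system of formulas defines `B₁` in all the geometries of regular planes and their lines. -/
theorem exists_defines : ∃ D : GeometryDefinition,
    ∀ (F : Type u) [Field F] [CharP F 2] (V : Type v) [AddCommGroup V] [Module F V]
      [FiniteDimensional F V] (ξ : PseudoPolarity F V) (e : V) (P : Set (Submodule F V)),
      IsFrame ξ e P → D.Defines (ξ.planeGeometry P) ξ.B₁ LiesOn := by
  -- The formulas are fixed before the field, the space and the form, which gives uniformity.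
  obtain ⟨dom, eqv, rel, star, h⟩ := exists_geometryDefinition.{v}
  refine ⟨⟨4, dom, eqv, rel, star⟩, fun F _ _ V _ _ _ ξ e P hf => ?_⟩
  obtain ⟨hdom, heqv, hpt, hinc, hstar⟩ := h (ξ.planeGeometry P)
  have hex : ∀ x : {x : Fin 4 → (ξ.planeGeometry P).Obj // dom.Realize x},
      ∃ o, ξ.RepresentsObj P x.1 o := fun x => hf.exists_representsObj ((hdom x.1).1 x.2)
  choose c hc using hex
  refine ⟨c, fun o => ?_, fun x y => ?_, fun {n} r x => ?_, fun x p hp L => ?_⟩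
  · obtain ⟨x, hx, ho⟩ := hf.exists_tuple o
    exact ⟨⟨x, (hdom x).2 hx⟩, (hc _).eq ho⟩
  · exact (hf.eqvObj_iff (hc x) (hc y)).symm.trans (heqv x.1 y.1).symm
  · cases r with
    | point => exact (hf.sameObj_iff_exists (hc (x 0))).symm.trans (hpt fun ij => (x ij.1).1 ij.2).symm
    | inc => exact (hf.incidentObj_iff (hc (x 0)) (hc (x 1))).symm.trans (hinc fun ij => (x ij.1).1 ij.2).symm
  · have hx := hc x
    rw [hp] at hx
    exact (hf.throughObj_iff_liesOn hx L).symm.trans (hstar x.1 _).symm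

end PseudoPolarity

theorem theorem5p14 :
    (∃ D : GeometryDefinition,
      ∀ (F : Type u) [Field F] [CharP F 2] [PerfectField F] (V : Type v) [AddCommGroup V]
        [Module F V] [FiniteDimensional F V] (ξ : PseudoPolarity F V),
        5 ≤ ENat.card F → 4 ≤ Module.finrank F V →
          D.Defines ξ.B₂ ξ.B₁ PseudoPolarity.LiesOn) ∧
    (∃ D : GeometryDefinition,
      ∀ (F : Type u) [Field F] [CharP F 2] [PerfectField F] (V : Type v) [AddCommGroup V]
        [Module F V] [FiniteDimensional F V] (ξ : PseudoPolarity F V),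
        5 ≤ ENat.card F → 4 ≤ Module.finrank F V →
          D.Defines ξ.C₂ ξ.B₁ PseudoPolarity.LiesOn) := by
  obtain ⟨D, hD⟩ := PseudoPolarity.exists_defines.{u, v}
  refine ⟨⟨D, ?_⟩, ⟨D, ?_⟩⟩ <;> intro F _ _ _ V _ _ _ ξ hF hV <;>
    obtain ⟨e, he⟩ := ξ.exists_isPole
  · exact hD F V ξ e _ ⟨he, hV, PseudoPolarity.exists_seven_le_card hF, Or.inl rfl⟩
  · exact hD F V ξ e _ ⟨he, hV, PseudoPolarity.exists_seven_le_card hF, Or.inr rfl⟩
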